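/- Write $\mathcal L=\mathbb Z\times\{0\}\subset\mathbb R^2$, $\mathbf x^\perp=(-x_2,x_1)$, and identify $\mathbb R^2$ with $\mathbb C$ by $\mathbf x=(x_1,x_2)\leftrightarrow z=x_1+ix_2$. Let $$K_\infty(\mathbf x)=\tfrac12\big[\cot(\pi\bar z)\big]^\perp,\qquad \rho(\mathbf x)=\big(\sin^2(\pi x_1)+\sinh^2(\pi x_2)\big)^{1/2}.$$ For a vector field $\mathbf v$ write $(\nabla\mathbf v)_{ij}=\partial_j v^i$. Then $K_\infty$ is differentiable on $\mathbb R^2\setminus\mathcal L$, where $\rho>0$ and $$\nabla K_\infty(\mathbf x)=\frac{\pi}{2}\,\frac{\beta(\mathbf x)}{\rho(\mathbf x)^2},\qquad \beta(\mathbf x)=\frac1{2\rho(\mathbf x)^2}\begin{pmatrix}\sin(2\pi x_1)\sinh(2\pi x_2)&\cos(2\pi x_1)\cosh(2\pi x_2)-1\\ \cos(2\pi x_1)\cosh(2\pi x_2)-1&-\sin(2\pi x_1)\sinh(2\pi x_2)\end{pmatrix}.$$ Let $\omega\in L^\infty(\mathbb R^2)$ be real-valued and compactly supported. Then $\mathbf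 u=K_\infty*\omega$ is given by an absolutely convergent integral at every point, $\mathbf u$ is locally integrable and has a locally integrable weak (distributional) gradient $\nabla\mathbf u$, and for almost every $\mathbf x\in\mathbb R^2$ the principal value below exists and $$\nabla\mathbf u(\mathbf x)=\sum_{n\in\mathbb Z}\frac{\omega(\mathbf x+(n,0))}2\begin{pmatrix}0&-1\\1&0\end{pmatrix}+\operatorname{PV}\!\!\int_{\mathbb R^2}\nabla K_\infty(\mathbf x-\mathbf y)\,\omega(\mathbf y)\,d\mathbf y .$$ Here the sum has only finitely many nonzero terms for each $\mathbf x$, and $$\operatorname{PV}\!\!\int_{\mathbb R^2}\nabla K_\infty(\mathbf x-\mathbf y)\,\omega(\mathbf y)\,d\mathbf y=\lim_{r\to0^+}\int_{\mathbb R^2\setminus U_r(\mathbf x)}\nabla K_\infty(\mathbf x-\mathbf y)\,\omega(\mathbf y)\,d\mathbf y,\qquad U_r(\mathbf x)=\bigcup_{n\in\mathbb Z}B_r(\mathbf x+(n,0)),$$ where the integrals on the right converge absolutely for every $r>0$. -/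

import Mathlib

open MeasureTheory Filter Topology
open scoped ENNReal

noncomputable section

namespace PeriodicBiotSavart

/-- The Euclidean plane `ℝ²`; the coordinates `x₁, x₂` of `x` are `x 0, x 1`. -/
abbrev Plane : Type := EuclideanSpace ℝ (Fin 2)

/-- The lattice vector `(n, 0)`. -/
def shift (n : ℤ) : Plane := !₂[(n : ℝ), 0]

/-- The lattice `ℤ × {0}`. -/
def lattice : Set Plane := Set.range shift

/-- A point of the plane as a complex number, `(x₁, x₂) ↦ x₁ + i x₂`. -/
def toC (x : Plane) : ℂ := ⟨x 0, x 1⟩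

/-- A complex number as a point of the plane. -/
def ofC (z : ℂ) : Plane := !₂[z.re, z.im]

/-- Counterclockwise rotation by 90 degrees, `(x₁, x₂) ↦ (-x₂, x₁)`. -/
def perp (x : Plane) : Plane := !₂[-x 1, x 0]

/-- The `x₁`-periodic Biot-Savart kernel `K_∞(x) = ½ [cot (π z̄)]^⊥`, `z = x₁ + i x₂`. -/
def Kinf (x : Plane) : Plane :=
  (1 / 2 : ℝ) • perp (ofC (Complex.cot ((Real.pi : ℂ) * (starRingEnd ℂ) (toC x))))

/-- `ρ(x) = (sin² (π x₁) + sinh² (π x₂))^{1/2}`. -/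
def rho (x : Plane) : ℝ :=
  Real.sqrt (Real.sin (Real.pi * x 0) ^ 2 + Real.sinh (Real.pi * x 1) ^ 2)

/-- The matrix `β(x)`. -/
def beta (x : Plane) : Matrix (Fin 2) (Fin 2) ℝ :=
  (1 / (2 * rho x ^ 2)) •
    !![Real.sin (2 * Real.pi * x 0) * Real.sinh (2 * Real.pi * x 1),
        Real.cos (2 * Real.pi * x 0) * Real.cosh (2 * Real.pi * x 1) - 1;
      Real.cos (2 * Real.pi * x 0) * Real.cosh (2 * Real.pi * x 1) - 1,
        -(Real.sin (2 * Real.pi * x 0) * Real.sinh (2 * Real.pi * x 1))]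

/-- The classical gradient (Jacobian matrix) of a vector field, `(∇v)_{ij} = ∂_j v^i`. -/
def grad (v : Plane → Plane) (x : Plane) : Matrix (Fin 2) (Fin 2) ℝ :=
  Matrix.of fun i j => fderiv ℝ v x (EuclideanSpace.single j 1) i

/-- The velocity `u = K_∞ * ω`, that is `u(x) = ∫ ω(y) K_∞(x - y) dy`. -/
def velocity (ω : Plane → ℝ) : Plane → Plane :=
  convolution ω Kinf (ContinuousLinearMap.lsmul ℝ ℝ) volume

/-- `U_r(x)`, the union of the balls of radius `r` about the points `x + (n, 0)`, `n ∈ ℤ`: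
the singular set of `y ↦ K_∞(x - y)`, thickened by `r`. -/
def latticeBalls (x : Plane) (r : ℝ) : Set Plane :=
  ⋃ n : ℤ, Metric.ball (x + shift n) r

/-- `P` is the principal value `PV ∫ f(y) dy`, with singularities at `x + (n, 0)`, `n ∈ ℤ`:
`f` is (entrywise) absolutely integrable off `U_r(x)` for every `r > 0`, and its integrals there
converge to `P` as `r → 0⁺`. -/
def HasPrincipalValue (f : Plane → Matrix (Fin 2) (Fin 2) ℝ) (x : Plane)
    (P : Matrix (Fin 2) (Fin 2) ℝ) : Prop :=
  ∀ i j : Fin 2,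
    (∀ r : ℝ, 0 < r → IntegrableOn (fun y => f y i j) (latticeBalls x r)ᶜ volume) ∧
    Tendsto (fun r : ℝ => ∫ y in (latticeBalls x r)ᶜ, f y i j) (𝓝[>] 0) (𝓝 (P i j))

/-- `G` is the weak (distributional) gradient of the vector field `v`, `G_{ij} = ∂_j v^i`. -/
def HasWeakGradient (v : Plane → Plane) (G : Plane → Matrix (Fin 2) (Fin 2) ℝ) : Prop :=
  LocallyIntegrable v volume ∧
  (∀ i j : Fin 2, LocallyIntegrable (fun x => G x i j) volume) ∧
  ∀ (i j : Fin 2) (φ : Plane → ℝ), ContDiff ℝ (⊤ : ℕ∞) φ → HasCompactSupport φ →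
    ∫ x, v x i * fderiv ℝ φ x (EuclideanSpace.single j 1) = -∫ x, G x i j * φ x

end PeriodicBiotSavart

end

noncomputable section

namespace PeriodicBiotSavart

open scoped ContDiff ComplexConjugate

/-! Under the identification with `ℂ`, `K_∞` is the real-linear image `(Im f, Re f)` of the
meromorphic function `f(z) = ½ cot(πz)`. On a disc, `f` is half a finite sum of translates of the
Cauchy kernel `1/(πz)` plus a holomorphic remainder, so everything reduces to the Cauchy transform
`Cw` of a bounded, compactly supported `w`: its `∂/∂z̄` is `w`, and its `∂/∂z` should be the
principal value of `-1/(πz²)` against `w`.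

Almost everywhere existence of that principal value needs no Calderón-Zygmund theory or maximal
function. The average of `1/(πz)` over a disc of radius `r` is Lipschitz
(`lipschitzWith_regKernel`); its `∂/∂z̄` is the normalized indicator of the disc, and its `∂/∂z` is
exactly `-1/(πz²)` cut off at radius `r`. Since the two derivatives commute, the truncated integral
of `∂ψ/∂z̄` equals the disc average of `∂ψ/∂z` (`truncKernel_conv_dzbar`). The functions `∂ψ/∂z̄`
are dense in `L²` by a Liouville argument (`dense_dzbarRange`), and `‖∂ψ/∂z‖₂ = ‖∂ψ/∂z̄‖₂`
(`eLpNorm_dz`), so the identity extends: the truncated integrals of `w ∈ L²` are the disc averages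
of one function `D ∈ L²` (`exists_truncKernel_eq_discKernel`). Lebesgue differentiation gives
convergence to `D` almost everywhere, and pairing with test functions shows that `D` is the weak
`∂/∂z` of `Cw` (`cauchyTransform_dz`).

Summing translates gives a weak gradient on every disc (`exists_local_gradient`). The `∂/∂z̄` part
is half the sum of the translates of `ω`; being real, it becomes a multiple of the rotation matrix,
while the `∂/∂z` part becomes the symmetric traceless principal value. -/

/-- The Cauchy kernel `1 / (π z)`. -/
def cauchyKernel (z : ℂ) : ℂ := ((Real.pi : ℂ) * z)⁻¹

/-- The mean of the Cauchy kernel over the disc of radius `r` about `z`. -/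
def regKernel (r : ℝ) (z : ℂ) : ℂ :=
  ((Real.pi * max (r ^ 2) (‖z‖ ^ 2))⁻¹ : ℝ) • conj z

/-- The normalized indicator function of the disc of radius `r`. -/
def discKernel (r : ℝ) (z : ℂ) : ℂ :=
  if ‖z‖ ≤ r then (((Real.pi * r ^ 2)⁻¹ : ℝ) : ℂ) else 0

/-- The kernel `-1 / (π z²)` truncated at radius `r`. -/
def truncKernel (r : ℝ) (z : ℂ) : ℂ :=
  if r ≤ ‖z‖ then -((Real.pi : ℂ) * z ^ 2)⁻¹ else 0

/-- The Wirtinger derivative `∂φ/∂z`. -/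
def dz (φ : ℂ → ℂ) (z : ℂ) : ℂ :=
  (fderiv ℝ φ z 1 - Complex.I * fderiv ℝ φ z Complex.I) / 2

/-- The Wirtinger derivative `∂φ/∂z̄`. -/
def dzbar (φ : ℂ → ℂ) (z : ℂ) : ℂ :=
  (fderiv ℝ φ z 1 + Complex.I * fderiv ℝ φ z Complex.I) / 2

/-! ### The regularized Cauchy kernel and its derivatives. -/

theorem regKernel_of_le {r : ℝ} {z : ℂ} (hz : ‖z‖ ≤ r) :
    regKernel r z = ((Real.pi * r ^ 2)⁻¹ : ℝ) • conj z := by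
  rw [regKernel, max_eq_left (by gcongr)]

theorem regKernel_of_ge {r : ℝ} (hr : 0 < r) {z : ℂ} (hz : r ≤ ‖z‖) :
    regKernel r z = cauchyKernel z := by
  have hz0 : z ≠ 0 := norm_pos_iff.1 (hr.trans_le hz)
  rw [regKernel, max_eq_right (by gcongr), cauchyKernel, mul_inv, mul_inv, Complex.inv_def z,
    Complex.normSq_eq_norm_sq]
  simp only [Complex.real_smul]
  push_cast
  ring

theorem regKernel_neg (r : ℝ) (z : ℂ) : regKernel r (-z) = -regKernel r z := by
  simp [regKernel]

theorem discKernel_neg (r : ℝ) (z : ℂ) : discKernel r (-z) = discKernel r z := by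
  simp [discKernel]

theorem truncKernel_neg (r : ℝ) (z : ℂ) : truncKernel r (-z) = truncKernel r z := by
  simp [truncKernel]

/-- This regularity is what allows integration by parts across the circle `‖z‖ = r` without boundary
terms. -/
theorem lipschitzWith_regKernel {r : ℝ} (hr : 0 < r) :
    LipschitzWith (Real.toNNReal (3 / (Real.pi * r ^ 2))) (regKernel r) := by
  apply LipschitzWith.of_dist_le_mul
  intro z w
  rw [Real.coe_toNNReal _ (by positivity), dist_eq_norm, dist_eq_norm]
  set A := max r ‖z‖ with hA
  set B := max r ‖w‖ with hB
  have hA2 : max (r ^ 2) (‖z‖ ^ 2) = A ^ 2 := by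
    rcases le_total r ‖z‖ with h | h
    · rw [hA, max_eq_right h, max_eq_right (by gcongr)]
    · rw [hA, max_eq_left h, max_eq_left (by gcongr)]
  have hB2 : max (r ^ 2) (‖w‖ ^ 2) = B ^ 2 := by
    rcases le_total r ‖w‖ with h | h
    · rw [hB, max_eq_right h, max_eq_right (by gcongr)]
    · rw [hB, max_eq_left h, max_eq_left (by gcongr)]
  have hrA : r ≤ A := le_max_left _ _
  have hrB : r ≤ B := le_max_left _ _
  have hA0 : 0 < A := hr.trans_le hrA
  have hB0 : 0 < B := hr.trans_le hrB
  have hwB : ‖w‖ ≤ B := le_max_right _ _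
  have hAB : |B - A| ≤ ‖z - w‖ := by
    refine (abs_max_sub_max_le_max r ‖w‖ r ‖z‖).trans ?_
    rw [sub_self, abs_zero, max_eq_right (abs_nonneg _), norm_sub_rev]
    exact abs_norm_sub_norm_le w z
  -- Uses `1/A² - 1/B² = (B - A)(1/(AB²) + 1/(A²B))`. The `conj (z - w)` term contributes `1` and
  -- the radial term `2` to the constant `3`.
  have key : regKernel r z - regKernel r w
      = (Real.pi⁻¹ : ℝ) • (((A ^ 2)⁻¹ : ℝ) • conj (z - w)
        + ((B - A) * ((A * B ^ 2)⁻¹ + (A ^ 2 * B)⁻¹) : ℝ) • conj w) := by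
    rw [regKernel, regKernel, hA2, hB2]
    have hAc : (A : ℂ) ≠ 0 := by exact_mod_cast hA0.ne'
    have hBc : (B : ℂ) ≠ 0 := by exact_mod_cast hB0.ne'
    have hpi : (Real.pi : ℂ) ≠ 0 := by exact_mod_cast Real.pi_ne_zero
    simp only [Complex.real_smul, map_sub]
    push_cast
    field_simp
    ring
  rw [key, norm_smul, Real.norm_of_nonneg (by positivity)]
  have h1 : ‖((A ^ 2)⁻¹ : ℝ) • conj (z - w)‖ ≤ (r ^ 2)⁻¹ * ‖z - w‖ := by
    rw [norm_smul, Real.norm_of_nonneg (by positivity), RCLike.norm_conj]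
    gcongr
  have h2 : ‖((B - A) * ((A * B ^ 2)⁻¹ + (A ^ 2 * B)⁻¹) : ℝ) • conj w‖
      ≤ 2 * (r ^ 2)⁻¹ * ‖z - w‖ := by
    rw [norm_smul, RCLike.norm_conj, norm_mul, Real.norm_eq_abs,
      Real.norm_of_nonneg (by positivity)]
    calc |B - A| * ((A * B ^ 2)⁻¹ + (A ^ 2 * B)⁻¹) * ‖w‖
        ≤ ‖z - w‖ * ((A * B ^ 2)⁻¹ + (A ^ 2 * B)⁻¹) * B := by gcongr
      _ = ((A * B)⁻¹ + (A * A)⁻¹) * ‖z - w‖ := by field_simp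
      _ ≤ ((r * r)⁻¹ + (r * r)⁻¹) * ‖z - w‖ := by gcongr
      _ = 2 * (r ^ 2)⁻¹ * ‖z - w‖ := by ring
  calc Real.pi⁻¹ * ‖((A ^ 2)⁻¹ : ℝ) • conj (z - w)
        + ((B - A) * ((A * B ^ 2)⁻¹ + (A ^ 2 * B)⁻¹) : ℝ) • conj w‖
      ≤ Real.pi⁻¹ * ((r ^ 2)⁻¹ * ‖z - w‖ + 2 * (r ^ 2)⁻¹ * ‖z - w‖) := by
        gcongr; exact (norm_add_le _ _).trans (add_le_add h1 h2)
    _ = 3 / (Real.pi * r ^ 2) * ‖z - w‖ := by field_simp; ring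

theorem hasDerivAt_cauchyKernel {z : ℂ} (hz : z ≠ 0) :
    HasDerivAt cauchyKernel (-((Real.pi : ℂ) * z ^ 2)⁻¹) z := by
  have hpi : (Real.pi : ℂ) ≠ 0 := by exact_mod_cast Real.pi_ne_zero
  have := ((hasDerivAt_id z).const_mul (Real.pi : ℂ)).inv (mul_ne_zero hpi hz)
  have e2 : -((Real.pi : ℂ) * z ^ 2)⁻¹
      = -((Real.pi : ℂ) * 1) / ((Real.pi : ℂ) * id z) ^ 2 := by
    simp only [id]; field_simp
  rw [e2]
  exact this

/-- Inside the disc the kernel is a multiple of `conj z`, so only `∂/∂z̄` survives; outside it is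
holomorphic, so only `∂/∂z` does. Hence `∂/∂z̄` of `regKernel` is `discKernel` and `∂/∂z` is
`truncKernel`. -/
theorem hasLineDerivAt_regKernel {r : ℝ} (hr : 0 < r) {z : ℂ} (hz : ‖z‖ ≠ r) (v : ℂ) :
    HasLineDerivAt ℝ (regKernel r) (discKernel r z * conj v + truncKernel r z * v) z v := by
  rcases lt_or_gt_of_ne hz with h | h
  · have e : regKernel r =ᶠ[𝓝 z] fun w => ((Real.pi * r ^ 2)⁻¹ : ℝ) • Complex.conjCLE w := by
      filter_upwards [(continuous_norm.tendsto z).eventually (gt_mem_nhds h)] with w hw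
      exact regKernel_of_le hw.le
    have : HasFDerivAt (regKernel r)
        (((Real.pi * r ^ 2)⁻¹ : ℝ) • (Complex.conjCLE : ℂ →L[ℝ] ℂ)) z :=
      ((Complex.conjCLE : ℂ →L[ℝ] ℂ).hasFDerivAt.const_smul _).congr_of_eventuallyEq e
    have e2 : discKernel r z * conj v + truncKernel r z * v
        = (((Real.pi * r ^ 2)⁻¹ : ℝ) • (Complex.conjCLE : ℂ →L[ℝ] ℂ)) v := by
      simp [discKernel, truncKernel, h.le, h.not_ge]
    rw [e2]
    exact this.hasLineDerivAt v
  · have e : regKernel r =ᶠ[𝓝 z] cauchyKernel := by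
      filter_upwards [(continuous_norm.tendsto z).eventually (lt_mem_nhds h)] with w hw
      exact regKernel_of_ge hr hw.le
    have hz0 : z ≠ 0 := norm_pos_iff.1 (hr.trans h)
    have h1 := hasDerivAt_cauchyKernel hz0
    have h2 := ((h1.hasFDerivAt.restrictScalars ℝ).congr_of_eventuallyEq e).hasLineDerivAt v
    have e2 : discKernel r z * conj v + truncKernel r z * v
        = ((ContinuousLinearMap.toSpanSingleton ℂ (-((Real.pi : ℂ) * z ^ 2)⁻¹)).restrictScalars ℝ)
          v := by
      simp [discKernel, truncKernel, h.le, h.not_ge, mul_comm]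
    rw [e2]
    exact h2

/-! ### Integration by parts and Wirtinger derivatives. -/

/-- Integration by parts against a real Lipschitz function. -/
theorem integral_lineDeriv_mul_real {f f' θ : ℂ → ℝ} {C : NNReal} {v : ℂ}
    (hf : LipschitzWith C f) (hf' : ∀ᵐ x, HasLineDerivAt ℝ f (f' x) x v)
    (hθ : ContDiff ℝ 1 θ) (hc : HasCompactSupport θ) :
    Integrable (fun x => f' x * θ x) ∧ Integrable (fun x => f x * fderiv ℝ θ x v) ∧
      ∫ x, f' x * θ x = -∫ x, f x * fderiv ℝ θ x v := by
  have e : (fun x => f' x) =ᵐ[volume] fun x => lineDeriv ℝ f x v := by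
    filter_upwards [hf'] with x hx using hx.lineDeriv.symm
  have hint := (hθ.continuous.integrable_of_hasCompactSupport hc (μ := volume))
  refine ⟨?_, ?_, ?_⟩
  · refine (hint.bdd_mul (c := C * ‖v‖)
      (aestronglyMeasurable_lineDeriv hf.continuous _ |>.congr e.symm) ?_)
    filter_upwards [e] with x hx
    rw [hx]
    exact norm_lineDeriv_le_of_lipschitz ℝ hf
  · apply Continuous.integrable_of_hasCompactSupport
    · exact hf.continuous.mul ((hθ.continuous_fderiv one_ne_zero).clm_apply continuous_const)
    · exact (hc.fderiv_apply ℝ v).mul_left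
  · obtain ⟨D, hD⟩ := hθ.lipschitzWith_of_hasCompactSupport hc one_ne_zero
    rw [integral_congr_ae (g := fun x => lineDeriv ℝ f x v * θ x)
      (by filter_upwards [e] with x hx; rw [hx]), hf.integral_lineDeriv_mul_eq hD hc,
      ← integral_neg]
    refine integral_congr_ae (Eventually.of_forall fun x => ?_)
    have := (hθ.differentiable one_ne_zero x).lineDeriv_eq_fderiv (v := -v)
    simp only [this, map_neg]
    ring

/-- Integration by parts against a complex Lipschitz function. -/
theorem integral_lineDeriv_mul_complex {f f' θ : ℂ → ℂ} {C : NNReal} {v : ℂ}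
    (hf : LipschitzWith C f) (hf' : ∀ᵐ x, HasLineDerivAt ℝ f (f' x) x v)
    (hθ : ContDiff ℝ 1 θ) (hc : HasCompactSupport θ) :
    Integrable (fun x => f' x * θ x) ∧ Integrable (fun x => f x * fderiv ℝ θ x v) ∧
      ∫ x, f' x * θ x = -∫ x, f x * fderiv ℝ θ x v := by
  -- A complex product splits into four products of real coordinates, to each of which the real
  -- version applies.
  have part : ∀ L L' : ℂ →L[ℝ] ℝ,
      Integrable (fun x => L (f' x) * L' (θ x)) ∧
      Integrable (fun x => L (f x) * L' (fderiv ℝ θ x v)) ∧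
      ∫ x, L (f' x) * L' (θ x) = -∫ x, L (f x) * L' (fderiv ℝ θ x v) := by
    intro L L'
    have h := integral_lineDeriv_mul_real (f := fun x => L (f x)) (f' := fun x => L (f' x))
      (θ := fun x => L' (θ x)) (v := v) (C := ‖L‖₊ * C) (L.lipschitz.comp hf) ?_
      (L'.contDiff.comp hθ) (hc.comp_left (map_zero L'))
    · have e : ∀ x, fderiv ℝ (fun x => L' (θ x)) x v = L' (fderiv ℝ θ x v) := fun x => by
        have := (L'.hasFDerivAt.comp x (hθ.differentiable one_ne_zero x).hasFDerivAt).fderiv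
        exact congrArg (fun T => T v) this
      simpa only [e] using h
    · filter_upwards [hf'] with x hx
      have : HasDerivAt (fun t : ℝ => f (x + t • v)) (f' x) 0 := hx
      exact L.hasFDerivAt.comp_hasDerivAt (0 : ℝ) this
  have mul_eq : ∀ a b : ℂ, a * b
      = ((Complex.reCLM a * Complex.reCLM b - Complex.imCLM a * Complex.imCLM b : ℝ) : ℂ)
        + Complex.I
          * ((Complex.reCLM a * Complex.imCLM b + Complex.imCLM a * Complex.reCLM b : ℝ) : ℂ) := by
    intro a b
    apply Complex.ext <;> simp
  obtain ⟨a1, b1, c1⟩ := part Complex.reCLM Complex.reCLM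
  obtain ⟨a2, b2, c2⟩ := part Complex.imCLM Complex.imCLM
  obtain ⟨a3, b3, c3⟩ := part Complex.reCLM Complex.imCLM
  obtain ⟨a4, b4, c4⟩ := part Complex.imCLM Complex.reCLM
  rw [funext fun x => mul_eq (f' x) (θ x), funext fun x => mul_eq (f x) (fderiv ℝ θ x v)]
  refine ⟨(a1.sub a2).ofReal.add ((a3.add a4).ofReal.const_mul _),
    (b1.sub b2).ofReal.add ((b3.add b4).ofReal.const_mul _), ?_⟩
  rw [integral_add (a1.sub a2).ofReal ((a3.add a4).ofReal.const_mul _),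
    integral_add (b1.sub b2).ofReal ((b3.add b4).ofReal.const_mul _),
    integral_const_mul, integral_const_mul, integral_complex_ofReal, integral_complex_ofReal,
    integral_complex_ofReal, integral_complex_ofReal, integral_sub a1 a2, integral_add a3 a4,
    integral_sub b1 b2, integral_add b3 b4, c1, c2, c3, c4]
  push_cast
  ring

theorem contDiff_fderiv_apply_infty {φ : ℂ → ℂ} (hφ : ContDiff ℝ ∞ φ) (v : ℂ) :
    ContDiff ℝ ∞ (fun z => fderiv ℝ φ z v) :=
  (hφ.fderiv_right (m := ∞) (by simp)).clm_apply contDiff_const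

theorem contDiff_dz {φ : ℂ → ℂ} (hφ : ContDiff ℝ ∞ φ) : ContDiff ℝ ∞ (dz φ) :=
  ((contDiff_fderiv_apply_infty hφ 1).sub
    (contDiff_const.mul (contDiff_fderiv_apply_infty hφ Complex.I))).div_const _

theorem contDiff_dzbar {φ : ℂ → ℂ} (hφ : ContDiff ℝ ∞ φ) : ContDiff ℝ ∞ (dzbar φ) :=
  ((contDiff_fderiv_apply_infty hφ 1).add
    (contDiff_const.mul (contDiff_fderiv_apply_infty hφ Complex.I))).div_const _

theorem hasCompactSupport_dz {φ : ℂ → ℂ} (hφ : HasCompactSupport φ) :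
    HasCompactSupport (dz φ) :=
  (hφ.fderiv ℝ).comp_left
    (g := fun T : ℂ →L[ℝ] ℂ => (T 1 - Complex.I * T Complex.I) / 2) (by simp)

theorem hasCompactSupport_dzbar {φ : ℂ → ℂ} (hφ : HasCompactSupport φ) :
    HasCompactSupport (dzbar φ) :=
  (hφ.fderiv ℝ).comp_left
    (g := fun T : ℂ →L[ℝ] ℂ => (T 1 + Complex.I * T Complex.I) / 2) (by simp)

/-- `∂/∂z` and `∂/∂z̄` commute. -/
theorem dz_dzbar_comm {φ : ℂ → ℂ} (hφ : ContDiff ℝ ∞ φ) (z : ℂ) :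
    dz (dzbar φ) z = dzbar (dz φ) z := by
  have hd : ∀ v, DifferentiableAt ℝ (fun z => fderiv ℝ φ z v) z := fun v =>
    (contDiff_fderiv_apply_infty hφ v).differentiable (by simp) z
  have h2 : ∀ v w, fderiv ℝ (fun z => fderiv ℝ φ z v) z w = fderiv ℝ (fderiv ℝ φ) z w v := by
    intro v w
    have := (hφ.fderiv_right (m := ∞) (by simp)).differentiable (by simp) z
    rw [fderiv_clm_apply this (differentiableAt_const v)]
    simp
  have hs : fderiv ℝ (fderiv ℝ φ) z 1 Complex.I = fderiv ℝ (fderiv ℝ φ) z Complex.I 1 :=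
    (hφ.contDiffAt.isSymmSndFDerivAt (by
    simpa using WithTop.coe_le_coe.2 (le_top : (2 : ℕ∞) ≤ ⊤))).eq 1 Complex.I
  have e1 : ∀ w, fderiv ℝ (dzbar φ) z w = (fderiv ℝ (fderiv ℝ φ) z w 1
      + Complex.I * fderiv ℝ (fderiv ℝ φ) z w Complex.I) / 2 := by
    intro w
    have := (((hd 1).hasFDerivAt.add ((hd Complex.I).hasFDerivAt.const_mul Complex.I)).mul_const
      ((2 : ℂ)⁻¹)).fderiv
    have h3 := congrArg (fun T => T w) this
    simp only [smul_apply, add_apply, h2,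
      smul_eq_mul] at h3
    rw [div_eq_inv_mul, ← h3]
    rfl
  have e2 : ∀ w, fderiv ℝ (dz φ) z w = (fderiv ℝ (fderiv ℝ φ) z w 1
      - Complex.I * fderiv ℝ (fderiv ℝ φ) z w Complex.I) / 2 := by
    intro w
    have := (((hd 1).hasFDerivAt.sub ((hd Complex.I).hasFDerivAt.const_mul Complex.I)).mul_const
      ((2 : ℂ)⁻¹)).fderiv
    have h3 := congrArg (fun T => T w) this
    simp only [smul_apply, sub_apply, h2,
      smul_eq_mul] at h3
    rw [div_eq_inv_mul, ← h3]
    rfl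
  rw [dz, dzbar, e1, e1, e2, e2, hs]
  ring

theorem fderiv_apply_eq_dz_dzbar (φ : ℂ → ℂ) (z : ℂ) :
    fderiv ℝ φ z 1 = dz φ z + dzbar φ z ∧
      fderiv ℝ φ z Complex.I = Complex.I * (dz φ z - dzbar φ z) := by
  rw [dz, dzbar]
  constructor
  · ring
  · linear_combination fderiv ℝ φ z Complex.I * Complex.I_mul_I

theorem ae_norm_sub_ne (x : ℂ) (r : ℝ) : ∀ᵐ y : ℂ, ‖x - y‖ ≠ r := by
  rcases eq_or_ne r 0 with rfl | hr
  · filter_upwards [Measure.ae_ne volume x] with y hy h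
    exact hy (sub_eq_zero.1 (norm_eq_zero.1 h)).symm
  · have := Measure.addHaar_sphere_of_ne_zero (volume : Measure ℂ) x hr
    filter_upwards [measure_eq_zero_iff_ae_notMem.1 this] with y hy h
    exact hy (by rw [mem_sphere_iff_norm, norm_sub_rev, h])

/-- The sign from integrating by parts cancels the sign from differentiating `y ↦ x - y`. The
exceptional circle has measure zero. -/
theorem regKernel_conv_fderiv {r : ℝ} (hr : 0 < r) {θ : ℂ → ℂ} (hθ : ContDiff ℝ ∞ θ)
    (hc : HasCompactSupport θ) (x v : ℂ) :
    Integrable (fun y => (discKernel r (x - y) * conj v + truncKernel r (x - y) * v) * θ y) ∧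
    Integrable (fun y => regKernel r (x - y) * fderiv ℝ θ y v) ∧
    ∫ y, (discKernel r (x - y) * conj v + truncKernel r (x - y) * v) * θ y
      = ∫ y, regKernel r (x - y) * fderiv ℝ θ y v := by
  have hl : LipschitzWith (Real.toNNReal (3 / (Real.pi * r ^ 2)))
      (fun y => regKernel r (x - y)) := by
    have h := (lipschitzWith_regKernel hr).comp ((LipschitzWith.const x).sub LipschitzWith.id)
    rw [zero_add, mul_one] at h
    exact h
  have hd : ∀ᵐ y, HasLineDerivAt ℝ (fun y => regKernel r (x - y))
      (-(discKernel r (x - y) * conj v + truncKernel r (x - y) * v)) y v := by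
    filter_upwards [ae_norm_sub_ne x r] with y hy
    have h := hasLineDerivAt_regKernel hr hy (-v)
    have h2 : HasDerivAt (fun t : ℝ => regKernel r (x - y + t • (-v)))
      (discKernel r (x - y) * conj (-v) + truncKernel r (x - y) * (-v)) 0 := h
    have h3 : HasDerivAt (fun t : ℝ => regKernel r (x - (y + t • v)))
      (-(discKernel r (x - y) * conj v + truncKernel r (x - y) * v)) 0 := by
      convert h2 using 1
      · funext t; congr 1; simp; ring
      · simp; ring
    exact h3
  obtain ⟨h1, h2, h3⟩ := integral_lineDeriv_mul_complex hl hd (hθ.of_le (by simp)) hc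
  simp only [neg_mul] at h1 h3
  rw [integral_neg] at h3
  exact ⟨by simpa using h1.neg, h2, neg_injective h3⟩

/-- Adding `I` times the derivative along `I` to the derivative along `1` doubles the `conj v`
coefficient and cancels the `v` coefficient; subtracting, as in `truncKernel_conv`, does the
opposite. -/
theorem discKernel_conv {r : ℝ} (hr : 0 < r) {θ : ℂ → ℂ} (hθ : ContDiff ℝ ∞ θ)
    (hc : HasCompactSupport θ) (x : ℂ) :
    ∫ y, discKernel r (x - y) * θ y = ∫ y, regKernel r (x - y) * dzbar θ y := by
  obtain ⟨a1, b1, c1⟩ := regKernel_conv_fderiv hr hθ hc x 1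
  obtain ⟨a2, b2, c2⟩ := regKernel_conv_fderiv hr hθ hc x Complex.I
  have e1 : ∀ y, discKernel r (x - y) * θ y = (2 : ℂ)⁻¹ *
      ((discKernel r (x - y) * conj 1 + truncKernel r (x - y) * 1) * θ y + Complex.I *
        ((discKernel r (x - y) * conj Complex.I + truncKernel r (x - y) * Complex.I) * θ y)) := by
    intro y
    simp only [map_one, Complex.conj_I]
    linear_combination (2 : ℂ)⁻¹ * (discKernel r (x - y) - truncKernel r (x - y)) * θ y *
      Complex.I_mul_I
  have e2 : ∀ y, regKernel r (x - y) * dzbar θ y = (2 : ℂ)⁻¹ *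
      (regKernel r (x - y) * fderiv ℝ θ y 1
        + Complex.I * (regKernel r (x - y) * fderiv ℝ θ y Complex.I)) := by
    intro y
    rw [dzbar]
    ring
  rw [funext e1, funext e2, integral_const_mul, integral_const_mul,
    integral_add a1 (a2.const_mul _), integral_add b1 (b2.const_mul _), integral_const_mul,
    integral_const_mul, c1, c2]

theorem truncKernel_conv {r : ℝ} (hr : 0 < r) {θ : ℂ → ℂ} (hθ : ContDiff ℝ ∞ θ)
    (hc : HasCompactSupport θ) (x : ℂ) :
    ∫ y, truncKernel r (x - y) * θ y = ∫ y, regKernel r (x - y) * dz θ y := by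
  obtain ⟨a1, b1, c1⟩ := regKernel_conv_fderiv hr hθ hc x 1
  obtain ⟨a2, b2, c2⟩ := regKernel_conv_fderiv hr hθ hc x Complex.I
  have e1 : ∀ y, truncKernel r (x - y) * θ y = (2 : ℂ)⁻¹ *
      ((discKernel r (x - y) * conj 1 + truncKernel r (x - y) * 1) * θ y - Complex.I *
        ((discKernel r (x - y) * conj Complex.I + truncKernel r (x - y) * Complex.I) * θ y)) := by
    intro y
    simp only [map_one, Complex.conj_I]
    linear_combination (2 : ℂ)⁻¹ * (truncKernel r (x - y) - discKernel r (x - y)) * θ y *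
      Complex.I_mul_I
  have e2 : ∀ y, regKernel r (x - y) * dz θ y = (2 : ℂ)⁻¹ *
      (regKernel r (x - y) * fderiv ℝ θ y 1
        - Complex.I * (regKernel r (x - y) * fderiv ℝ θ y Complex.I)) := by
    intro y
    rw [dz]
    ring
  rw [funext e1, funext e2, integral_const_mul, integral_const_mul,
    integral_sub a1 (a2.const_mul _), integral_sub b1 (b2.const_mul _), integral_const_mul,
    integral_const_mul, c1, c2]

/-- The truncated kernel maps `∂ψ/∂z̄` to the disc averages of `∂ψ/∂z`. -/
theorem truncKernel_conv_dzbar {r : ℝ} (hr : 0 < r) {ψ : ℂ → ℂ} (hψ : ContDiff ℝ ∞ ψ)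
    (hc : HasCompactSupport ψ) (x : ℂ) :
    ∫ y, truncKernel r (x - y) * dzbar ψ y = ∫ y, discKernel r (x - y) * dz ψ y := by
  -- Both sides are `regKernel r` convolved with the mixed derivative `∂²ψ/∂z∂z̄`.
  rw [truncKernel_conv hr (contDiff_dzbar hψ) (hasCompactSupport_dzbar hc),
    discKernel_conv hr (contDiff_dz hψ) (hasCompactSupport_dz hc)]
  simp only [dz_dzbar_comm hψ]

/-! ### Measurability, bounds and integrability of the kernels. -/

theorem measurable_discKernel (r : ℝ) : Measurable (discKernel r) :=
  Measurable.ite (measurableSet_le measurable_norm measurable_const) measurable_const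
    measurable_const

theorem measurable_truncKernel (r : ℝ) : Measurable (truncKernel r) :=
  Measurable.ite (measurableSet_le measurable_const measurable_norm)
    ((measurable_id.pow_const 2).const_mul _).inv.neg measurable_const

theorem measurable_cauchyKernel : Measurable cauchyKernel :=
  (measurable_id.const_mul _).inv

theorem norm_discKernel_le (r : ℝ) (z : ℂ) : ‖discKernel r z‖ ≤ (Real.pi * r ^ 2)⁻¹ := by
  rw [discKernel]
  split_ifs
  · rw [Complex.norm_real, Real.norm_of_nonneg (by positivity)]
  · simp; positivity

theorem norm_truncKernel_le {r : ℝ} (hr : 0 < r) (z : ℂ) :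
    ‖truncKernel r z‖ ≤ (Real.pi * r ^ 2)⁻¹ := by
  rw [truncKernel]
  split_ifs with h
  · rw [norm_neg, norm_inv, norm_mul, norm_pow, Complex.norm_real,
      Real.norm_of_nonneg Real.pi_pos.le]
    gcongr
  · simp; positivity

theorem norm_cauchyKernel (z : ℂ) : ‖cauchyKernel z‖ = (Real.pi * ‖z‖)⁻¹ := by
  rw [cauchyKernel, norm_inv, norm_mul, Complex.norm_real, Real.norm_of_nonneg Real.pi_pos.le]

theorem norm_regKernel_le {r : ℝ} (hr : 0 < r) (z : ℂ) : ‖regKernel r z‖ ≤ ‖cauchyKernel z‖ := by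
  rcases eq_or_ne z 0 with rfl | hz
  · simp [regKernel, cauchyKernel]
  have hz0 : 0 < ‖z‖ := norm_pos_iff.2 hz
  rw [norm_cauchyKernel, regKernel, norm_smul, Real.norm_of_nonneg (by positivity),
    RCLike.norm_conj]
  calc (Real.pi * max (r ^ 2) (‖z‖ ^ 2))⁻¹ * ‖z‖ ≤ (Real.pi * ‖z‖ ^ 2)⁻¹ * ‖z‖ := by
        gcongr; exact le_max_right _ _
    _ = (Real.pi * ‖z‖)⁻¹ := by field_simp

theorem norm_regKernel_le_inv {r : ℝ} (hr : 0 < r) (z : ℂ) :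
    ‖regKernel r z‖ ≤ (Real.pi * r)⁻¹ := by
  rcases le_total r ‖z‖ with h | h
  · rw [regKernel_of_ge hr h, norm_cauchyKernel]
    gcongr
  · rw [regKernel_of_le h, norm_smul, Real.norm_of_nonneg (by positivity), RCLike.norm_conj]
    calc (Real.pi * r ^ 2)⁻¹ * ‖z‖ ≤ (Real.pi * r ^ 2)⁻¹ * r := by gcongr
      _ = (Real.pi * r)⁻¹ := by field_simp

theorem tendsto_regKernel {z : ℂ} (hz : z ≠ 0) :
    Tendsto (fun r => regKernel r z) (𝓝[>] 0) (𝓝 (cauchyKernel z)) := by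
  apply tendsto_const_nhds.congr'
  filter_upwards [Ioo_mem_nhdsGT (norm_pos_iff.2 hz)] with r hr
  exact (regKernel_of_ge hr.1 hr.2.le).symm

theorem locallyIntegrable_cauchyKernel : LocallyIntegrable cauchyKernel := by
  refine locallyIntegrable_of_norm_le_rpow (C := Real.pi⁻¹) (α := 1) (by simp) (by simp) ?_ ?_
  · refine Eventually.of_forall fun z => ?_
    rw [norm_cauchyKernel, Real.rpow_neg_one, mul_inv]
  · exact measurable_cauchyKernel.aestronglyMeasurable

/-- In the plane `‖z‖⁻⁴` is integrable at infinity, and the truncation removes the origin.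
Membership in `L²` lets the truncated integrals pass to `L²` limits. -/
theorem memLp_two_truncKernel {r : ℝ} (hr : 0 < r) : MemLp (truncKernel r) 2 := by
  have hm := (measurable_truncKernel r).aestronglyMeasurable (μ := volume)
  rw [memLp_two_iff_integrable_sq_norm hm]
  -- The factor comes from `1 + ‖z‖ ≤ (r⁻¹ + 1)‖z‖`, valid when `r ≤ ‖z‖`.
  have hi := (integrable_one_add_norm (E := ℂ) (μ := volume) (r := 4)
    (by simp; norm_num)).const_mul ((Real.pi ^ 2)⁻¹ * (r⁻¹ + 1) ^ 4)
  refine hi.mono' (hm.norm.pow 2) (Eventually.of_forall fun z => ?_)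
  rw [Real.norm_of_nonneg (by positivity), Real.rpow_neg (by positivity),
    show (4 : ℝ) = (4 : ℕ) by norm_num, Real.rpow_natCast, truncKernel]
  split_ifs with h
  · have hz : 0 < ‖z‖ := hr.trans_le h
    have h1 : 1 + ‖z‖ ≤ (r⁻¹ + 1) * ‖z‖ := by
      have : 1 ≤ r⁻¹ * ‖z‖ := by
        rw [inv_mul_eq_div, le_div_iff₀ hr]; simpa using h
      linarith
    rw [norm_neg, norm_inv, norm_mul, norm_pow, Complex.norm_real,
      Real.norm_of_nonneg Real.pi_pos.le]
    calc (Real.pi * ‖z‖ ^ 2)⁻¹ ^ 2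
        = (Real.pi ^ 2)⁻¹ * (r⁻¹ + 1) ^ 4 * (((r⁻¹ + 1) * ‖z‖) ^ 4)⁻¹ := by field_simp
      _ ≤ (Real.pi ^ 2)⁻¹ * (r⁻¹ + 1) ^ 4 * ((1 + ‖z‖) ^ 4)⁻¹ := by gcongr
  · simp; positivity

/-! ### Equality of the `L²` norms of the two Wirtinger derivatives. -/

theorem integrable_of_contDiff {φ : ℂ → ℂ} (hφ : ContDiff ℝ ∞ φ) (hc : HasCompactSupport φ) :
    Integrable φ :=
  hφ.continuous.integrable_of_hasCompactSupport hc

theorem integral_mul_fderiv_test {f g : ℂ → ℂ} (hf : ContDiff ℝ ∞ f) (hg : ContDiff ℝ ∞ g)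
    (hc : HasCompactSupport g) (v : ℂ) :
    Integrable (fun x => f x * fderiv ℝ g x v) ∧ Integrable (fun x => fderiv ℝ f x v * g x) ∧
    ∫ x, f x * fderiv ℝ g x v = -∫ x, fderiv ℝ f x v * g x := by
  have h1 : Integrable (fun x => f x * fderiv ℝ g x v) :=
    integrable_of_contDiff (hf.mul (contDiff_fderiv_apply_infty hg v))
      ((hc.fderiv_apply ℝ v).mul_left)
  have h2 : Integrable (fun x => fderiv ℝ f x v * g x) :=
    integrable_of_contDiff ((contDiff_fderiv_apply_infty hf v).mul hg) hc.mul_left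
  have h3 : Integrable (fun x => f x * g x) := integrable_of_contDiff (hf.mul hg) hc.mul_left
  exact ⟨h1, h2, integral_mul_fderiv_eq_neg_fderiv_mul_of_integrable h2 h1 h3
    (fun x _ => hf.differentiable (by simp) x) (fun x _ => hg.differentiable (by simp) x)⟩

theorem integral_mul_dz {f g : ℂ → ℂ} (hf : ContDiff ℝ ∞ f) (hg : ContDiff ℝ ∞ g)
    (hc : HasCompactSupport g) : ∫ x, f x * dz g x = -∫ x, dz f x * g x := by
  obtain ⟨a1, b1, c1⟩ := integral_mul_fderiv_test hf hg hc 1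
  obtain ⟨a2, b2, c2⟩ := integral_mul_fderiv_test hf hg hc Complex.I
  have e1 : ∀ x, f x * dz g x = (2 : ℂ)⁻¹ *
      (f x * fderiv ℝ g x 1 - Complex.I * (f x * fderiv ℝ g x Complex.I)) := by
    intro x; rw [dz]; ring
  have e2 : ∀ x, dz f x * g x = (2 : ℂ)⁻¹ *
      (fderiv ℝ f x 1 * g x - Complex.I * (fderiv ℝ f x Complex.I * g x)) := by
    intro x; rw [dz]; ring
  rw [funext e1, funext e2, integral_const_mul, integral_const_mul,
    integral_sub a1 (a2.const_mul _), integral_sub b1 (b2.const_mul _), integral_const_mul,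
    integral_const_mul, c1, c2]
  ring

theorem integral_mul_dzbar {f g : ℂ → ℂ} (hf : ContDiff ℝ ∞ f) (hg : ContDiff ℝ ∞ g)
    (hc : HasCompactSupport g) : ∫ x, f x * dzbar g x = -∫ x, dzbar f x * g x := by
  obtain ⟨a1, b1, c1⟩ := integral_mul_fderiv_test hf hg hc 1
  obtain ⟨a2, b2, c2⟩ := integral_mul_fderiv_test hf hg hc Complex.I
  have e1 : ∀ x, f x * dzbar g x = (2 : ℂ)⁻¹ *
      (f x * fderiv ℝ g x 1 + Complex.I * (f x * fderiv ℝ g x Complex.I)) := by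
    intro x; rw [dzbar]; ring
  have e2 : ∀ x, dzbar f x * g x = (2 : ℂ)⁻¹ *
      (fderiv ℝ f x 1 * g x + Complex.I * (fderiv ℝ f x Complex.I * g x)) := by
    intro x; rw [dzbar]; ring
  rw [funext e1, funext e2, integral_const_mul, integral_const_mul,
    integral_add a1 (a2.const_mul _), integral_add b1 (b2.const_mul _), integral_const_mul,
    integral_const_mul, c1, c2]
  ring

theorem fderiv_conj {φ : ℂ → ℂ} (hφ : ContDiff ℝ ∞ φ) (z v : ℂ) :
    fderiv ℝ (fun z => conj (φ z)) z v = conj (fderiv ℝ φ z v) := by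
  have := ((Complex.conjCLE : ℂ →L[ℝ] ℂ).hasFDerivAt.comp z
    (hφ.differentiable (by simp) z).hasFDerivAt).fderiv
  exact congrArg (fun T => T v) this

theorem contDiff_conj {φ : ℂ → ℂ} (hφ : ContDiff ℝ ∞ φ) :
    ContDiff ℝ ∞ (fun z => conj (φ z)) :=
  (Complex.conjCLE : ℂ →L[ℝ] ℂ).contDiff.comp hφ

theorem hasCompactSupport_conj {φ : ℂ → ℂ} (hc : HasCompactSupport φ) :
    HasCompactSupport (fun z => conj (φ z)) :=
  hc.comp_left (map_zero (starRingEnd ℂ))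

theorem dz_conj {φ : ℂ → ℂ} (hφ : ContDiff ℝ ∞ φ) (z : ℂ) :
    dz (fun z => conj (φ z)) z = conj (dzbar φ z) := by
  rw [dz, dzbar, fderiv_conj hφ, fderiv_conj hφ]
  simp only [map_div₀, map_add, map_mul, Complex.conj_I, Complex.conj_ofNat]
  ring

theorem dzbar_conj {φ : ℂ → ℂ} (hφ : ContDiff ℝ ∞ φ) (z : ℂ) :
    dzbar (fun z => conj (φ z)) z = conj (dz φ z) := by
  rw [dz, dzbar, fderiv_conj hφ, fderiv_conj hφ]
  simp only [map_div₀, map_sub, map_mul, Complex.conj_I, Complex.conj_ofNat]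
  ring

/-- Conjugation exchanges `∂/∂z` and `∂/∂z̄`, so after one integration by parts both sides become
minus the integral of `conj ψ` against the same mixed derivative. This is the isometry property of
the Beurling transform. -/
theorem integral_norm_sq_dz {ψ : ℂ → ℂ} (hψ : ContDiff ℝ ∞ ψ) (hc : HasCompactSupport ψ) :
    ∫ x, ‖dz ψ x‖ ^ 2 = ∫ x, ‖dzbar ψ x‖ ^ 2 := by
  have h : ∫ x, dz ψ x * conj (dz ψ x) = ∫ x, dzbar ψ x * conj (dzbar ψ x) := by
    simp only [← dz_conj hψ, ← dzbar_conj hψ]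
    rw [integral_mul_dzbar (contDiff_dz hψ) (contDiff_conj hψ) (hasCompactSupport_conj hc),
      integral_mul_dz (contDiff_dzbar hψ) (contDiff_conj hψ) (hasCompactSupport_conj hc)]
    simp only [dz_dzbar_comm hψ]
  simp only [Complex.mul_conj, Complex.normSq_eq_norm_sq, integral_complex_ofReal] at h
  exact_mod_cast h

theorem memLp_of_contDiff {φ : ℂ → ℂ} (hφ : ContDiff ℝ ∞ φ) (hc : HasCompactSupport φ)
    (p : ℝ≥0∞) : MemLp φ p :=
  hφ.continuous.memLp_of_hasCompactSupport hc

/-- `∂/∂z` and `∂/∂z̄` of a test function have the same `L²` norm. -/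
theorem eLpNorm_dz {ψ : ℂ → ℂ} (hψ : ContDiff ℝ ∞ ψ) (hc : HasCompactSupport ψ) :
    eLpNorm (dz ψ) 2 volume = eLpNorm (dzbar ψ) 2 volume := by
  rw [(memLp_of_contDiff (contDiff_dz hψ) (hasCompactSupport_dz hc) 2).eLpNorm_eq_integral_rpow_norm
      (by simp) (by simp),
    (memLp_of_contDiff (contDiff_dzbar hψ)
      (hasCompactSupport_dzbar hc) 2).eLpNorm_eq_integral_rpow_norm (by simp) (by simp)]
  simp [integral_norm_sq_dz hψ hc]

/-! ### Density of `∂/∂z̄` of test functions in `L²`, and the Beurling transform. -/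

theorem fderiv_sub_apply_test {φ ψ : ℂ → ℂ} (hφ : ContDiff ℝ ∞ φ) (hψ : ContDiff ℝ ∞ ψ) (z v : ℂ) :
    fderiv ℝ (φ - ψ) z v = fderiv ℝ φ z v - fderiv ℝ ψ z v := by
  rw [fderiv_sub (hφ.differentiable (by simp) z) (hψ.differentiable (by simp) z)]
  rfl

theorem dz_sub {φ ψ : ℂ → ℂ} (hφ : ContDiff ℝ ∞ φ) (hψ : ContDiff ℝ ∞ ψ) :
    dz (φ - ψ) = dz φ - dz ψ := by
  funext z
  simp only [dz, Pi.sub_apply, fderiv_sub_apply_test hφ hψ]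
  ring

theorem dzbar_sub {φ ψ : ℂ → ℂ} (hφ : ContDiff ℝ ∞ φ) (hψ : ContDiff ℝ ∞ ψ) :
    dzbar (φ - ψ) = dzbar φ - dzbar ψ := by
  funext z
  simp only [dzbar, Pi.sub_apply, fderiv_sub_apply_test hφ hψ]
  ring

theorem fderiv_add_apply_test {φ ψ : ℂ → ℂ} (hφ : ContDiff ℝ ∞ φ) (hψ : ContDiff ℝ ∞ ψ) (z v : ℂ) :
    fderiv ℝ (φ + ψ) z v = fderiv ℝ φ z v + fderiv ℝ ψ z v := by
  rw [fderiv_add (hφ.differentiable (by simp) z) (hψ.differentiable (by simp) z)]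
  rfl

theorem dzbar_add {φ ψ : ℂ → ℂ} (hφ : ContDiff ℝ ∞ φ) (hψ : ContDiff ℝ ∞ ψ) :
    dzbar (φ + ψ) = dzbar φ + dzbar ψ := by
  funext z
  simp only [dzbar, Pi.add_apply, fderiv_add_apply_test hφ hψ]
  ring

theorem dzbar_const_smul {φ : ℂ → ℂ} (hφ : ContDiff ℝ ∞ φ) (c : ℂ) :
    dzbar (c • φ) = c • dzbar φ := by
  funext z
  have e : ∀ v, fderiv ℝ (c • φ) z v = c * fderiv ℝ φ z v := by
    intro v
    rw [fderiv_const_smul (hφ.differentiable (by simp) z)]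
    rfl
  simp only [dzbar, Pi.smul_apply, e, smul_eq_mul]
  ring

/-- The Cauchy-Schwarz inequality. -/
theorem enorm_integral_mul_le {f g : ℂ → ℂ} (hf : AEStronglyMeasurable f)
    (hg : AEStronglyMeasurable g) :
    ‖∫ x, f x * g x‖ₑ ≤ eLpNorm f 2 volume * eLpNorm g 2 volume := by
  refine (enorm_integral_le_lintegral_enorm _).trans ?_
  have := eLpNorm_smul_le_mul_eLpNorm (p := 2) (q := 2) (r := 1) hg hf
  rw [eLpNorm_one_eq_lintegral_enorm] at this
  simpa using this

theorem eLpNorm_comp_sub_left_test {g : ℂ → ℂ} (hg : AEStronglyMeasurable g) (x : ℂ) (p : ℝ≥0∞) :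
    eLpNorm (fun y => g (x - y)) p volume = eLpNorm g p volume :=
  eLpNorm_comp_measurePreserving hg (Measure.measurePreserving_sub_left volume x)

theorem fderiv_comp_sub_left {η : ℂ → ℂ} (hη : ContDiff ℝ ∞ η) (x t v : ℂ) :
    fderiv ℝ (fun t => η (x - t)) t v = -fderiv ℝ η (x - t) v := by
  have h1 : HasFDerivAt (fun t : ℂ => x - t) (-ContinuousLinearMap.id ℝ ℂ) t :=
    (hasFDerivAt_id t).const_sub x
  have := ((hη.differentiable (by simp) (x - t)).hasFDerivAt.comp t h1).fderiv
  have h2 := congrArg (fun T => T v) this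
  simp only [ContinuousLinearMap.comp_apply, neg_apply, ContinuousLinearMap.id_apply,
    map_neg] at h2
  exact h2

open Pointwise in
/-- A square-integrable function which is weakly holomorphic vanishes. -/
theorem ae_eq_zero_of_integral_mul_dzbar {h : ℂ → ℂ} (hh : MemLp h 2)
    (H : ∀ ψ : ℂ → ℂ, ContDiff ℝ ∞ ψ → HasCompactSupport ψ → ∫ x, h x * dzbar ψ x = 0) :
    ∀ᵐ x, h x = 0 := by
  have hloc : LocallyIntegrable h := hh.locallyIntegrable (by norm_num)
  -- The mollification `E = h * η` is entire and, by Cauchy-Schwarz, bounded, hence constant by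
  -- Liouville; the constant is then shown to be zero.
  have key : ∀ η : ℂ → ℂ, ContDiff ℝ ∞ η → HasCompactSupport η → ∫ t, h t * η (0 - t) = 0 := by
    intro η hη hc
    have hηm := hη.continuous.aestronglyMeasurable (μ := (volume : Measure ℂ))
    have hη2 : ∀ x, AEStronglyMeasurable (fun t => η (x - t)) (volume : Measure ℂ) := fun x =>
      (hη.continuous.comp (continuous_const.sub continuous_id)).aestronglyMeasurable
    have hηtop := (memLp_of_contDiff hη hc 2).eLpNorm_ne_top
    set E : ℂ → ℂ := fun x => ∫ t, h t * η (x - t) with hE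
    have hdiff : Differentiable ℂ E := by
      intro x
      have hd := hc.hasFDerivAt_convolution_right (ContinuousLinearMap.mul ℝ ℂ) hloc
        (hη.of_le (by simp)) x
      have hv : ∀ v, fderiv ℝ E x v = ∫ t, h t * fderiv ℝ η (x - t) v := by
        intro v
        have h1 : fderiv ℝ E x = _ := hd.fderiv
        rw [h1, convolution_precompR_apply _ hloc (hc.fderiv ℝ)
          (hη.continuous_fderiv (by simp))]
        rfl
      rw [differentiableAt_complex_iff_differentiableAt_real]
      -- The Cauchy-Riemann equation for `E` at `x` is the hypothesis `H` tested on `t ↦ η (x - t)`.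
      refine ⟨hd.differentiableAt, ?_⟩
      rw [hv, hv]
      have hint : ∀ v, Integrable (fun t => h t * fderiv ℝ η (x - t) v) := fun v =>
        (((hc.fderiv_apply ℝ v).convolutionExists_right (ContinuousLinearMap.mul ℝ ℂ) hloc
          (contDiff_fderiv_apply_infty hη v).continuous) x : _)
      have h0 := H (fun t => η (x - t)) (hη.comp (contDiff_const.sub contDiff_id))
        (hc.comp_homeomorph (Homeomorph.subLeft x))
      have e : ∀ t, h t * dzbar (fun t => η (x - t)) t = -((2 : ℂ)⁻¹ *
          (h t * fderiv ℝ η (x - t) 1 + Complex.I * (h t * fderiv ℝ η (x - t) Complex.I))) := by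
        intro t
        rw [dzbar, fderiv_comp_sub_left hη, fderiv_comp_sub_left hη]
        ring
      rw [funext e, integral_neg, integral_const_mul,
        integral_add (hint 1) ((hint Complex.I).const_mul _), integral_const_mul] at h0
      rw [smul_eq_mul]
      linear_combination (-2 * Complex.I) * -h0
        + (∫ t, h t * fderiv ℝ η (x - t) Complex.I) * Complex.I_mul_I
    have hbd : ∀ x, ‖E x‖ₑ ≤ eLpNorm h 2 volume * eLpNorm η 2 volume := by
      intro x
      have := enorm_integral_mul_le hh.1 (hη2 x)
      rwa [eLpNorm_comp_sub_left_test hηm] at this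
    have hrange : Bornology.IsBounded (Set.range E) := by
      rw [isBounded_iff_forall_norm_le]
      refine ⟨(eLpNorm h 2 volume * eLpNorm η 2 volume).toReal, ?_⟩
      rintro _ ⟨x, rfl⟩
      rw [← toReal_enorm]
      exact ENNReal.toReal_mono (ENNReal.mul_ne_top hh.eLpNorm_ne_top hηtop) (hbd x)
    have hconst := fun x => hdiff.apply_eq_apply_of_bounded hrange x 0
    -- `E` may be evaluated at a far point `x`, where a compactly supported approximation `g` of `h`
    -- and the translate of `η` have disjoint supports; only `h - g` contributes.
    have hsmall : ∀ ε : ℝ≥0∞, ε ≠ 0 → ‖E 0‖ₑ ≤ ε * eLpNorm η 2 volume := by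
      intro ε hε
      obtain ⟨g, hg1, hg2, hg3, hg4⟩ := hh.exists_hasCompactSupport_eLpNorm_sub_le (by simp) hε
      have hK : IsCompact (tsupport g + tsupport η) := IsCompact.add hg1 hc
      obtain ⟨x, hx⟩ := (Set.ne_univ_iff_exists_notMem _).1 hK.ne_univ
      have hz : ∀ t, g t * η (x - t) = 0 := by
        intro t
        by_contra hne
        apply hx
        have h1 : t ∈ tsupport g := subset_tsupport _ (left_ne_zero_of_mul hne)
        have h2 : x - t ∈ tsupport η := subset_tsupport _ (right_ne_zero_of_mul hne)
        exact ⟨t, h1, x - t, h2, by simp⟩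
      rw [← hconst x]
      have e : E x = ∫ t, (h - g) t * η (x - t) := by
        simp only [hE, Pi.sub_apply, sub_mul, hz, sub_zero]
      rw [e]
      refine (enorm_integral_mul_le (hh.1.sub hg4.1) (hη2 x)).trans ?_
      rw [eLpNorm_comp_sub_left_test hηm]
      gcongr
    have : ‖E 0‖ₑ = 0 := by
      have ht : Tendsto (fun ε : ℝ≥0∞ => ε * eLpNorm η 2 volume) (𝓝[>] 0) (𝓝 0) := by
        have := (ENNReal.continuous_mul_const hηtop).tendsto 0
        rw [zero_mul] at this
        exact this.mono_left nhdsWithin_le_nhds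
      refine le_antisymm (ge_of_tendsto ht ?_) zero_le
      filter_upwards [self_mem_nhdsWithin] with ε hε using hsmall ε (ne_of_gt hε)
    exact enorm_eq_zero.1 this
  refine ae_eq_zero_of_integral_contDiff_smul_eq_zero hloc fun g hg hgc => ?_
  have := key (fun t => (g (-t) : ℂ)) (Complex.ofRealCLM.contDiff.comp (hg.comp contDiff_neg))
    ((hgc.comp_homeomorph (Homeomorph.neg ℂ)).comp_left Complex.ofReal_zero)
  simpa [mul_comm] using this

/-- The space of `∂/∂z̄` derivatives of test functions, in `L²`. -/
def dzbarRange : Submodule ℂ (Lp ℂ 2 (volume : Measure ℂ)) where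
  carrier := {f | ∃ ψ : ℂ → ℂ, ContDiff ℝ ∞ ψ ∧ HasCompactSupport ψ ∧ f =ᵐ[volume] dzbar ψ}
  zero_mem' := ⟨0, contDiff_const, HasCompactSupport.zero, by
    filter_upwards [Lp.coeFn_zero ℂ 2 (volume : Measure ℂ)] with x hx
    rw [hx]
    simp [dzbar]⟩
  add_mem' := by
    rintro f g ⟨φ, h1, h2, h3⟩ ⟨ψ, k1, k2, k3⟩
    refine ⟨φ + ψ, h1.add k1, h2.add k2, ?_⟩
    filter_upwards [Lp.coeFn_add f g, h3, k3] with x hx hf hg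
    rw [hx, dzbar_add h1 k1, Pi.add_apply, Pi.add_apply, hf, hg]
  smul_mem' := by
    rintro c f ⟨φ, h1, h2, h3⟩
    refine ⟨c • φ, contDiff_const.smul h1, h2.smul_left, ?_⟩
    filter_upwards [Lp.coeFn_smul c f, h3] with x hx hf
    rw [hx, dzbar_const_smul h1, Pi.smul_apply, Pi.smul_apply, hf]

/-- The conjugate of an element orthogonal to the range is weakly holomorphic and in `L²`, hence
zero. -/
theorem dense_dzbarRange : dzbarRange.topologicalClosure = ⊤ := by
  rw [Submodule.topologicalClosure_eq_top_iff, Submodule.eq_bot_iff]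
  intro f hf
  rw [Submodule.mem_orthogonal] at hf
  have hf2 := Lp.memLp f
  have h0 : ∀ᵐ x, conj (f x) = 0 := by
    refine ae_eq_zero_of_integral_mul_dzbar hf2.star fun ψ hψ hc => ?_
    have hm := memLp_of_contDiff (contDiff_dzbar hψ) (hasCompactSupport_dzbar hc) 2
    have h := hf (hm.toLp _) ⟨ψ, hψ, hc, hm.coeFn_toLp⟩
    rw [L2.inner_def] at h
    have h2 := congrArg conj h
    rw [map_zero, ← integral_conj] at h2
    rw [← h2]
    refine integral_congr_ae ?_
    filter_upwards [hm.coeFn_toLp] with x hx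
    rw [hx]
    simp [mul_comm]
  rw [Lp.eq_zero_iff_ae_eq_zero]
  filter_upwards [h0] with x hx
  simpa using hx

/-- The `∂/∂z̄` derivatives of test functions are dense in `L²`. -/
theorem exists_dzbar_approx {w : ℂ → ℂ} (hw : MemLp w 2) {ε : ℝ≥0∞} (hε : ε ≠ 0) :
    ∃ ψ : ℂ → ℂ, ContDiff ℝ ∞ ψ ∧ HasCompactSupport ψ ∧ eLpNorm (dzbar ψ - w) 2 volume < ε := by
  have hmem : hw.toLp w ∈ closure (dzbarRange : Set (Lp ℂ 2 (volume : Measure ℂ))) := by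
    rw [← Submodule.topologicalClosure_coe, dense_dzbarRange]
    trivial
  obtain ⟨f, ⟨ψ, h1, h2, h3⟩, hlt⟩ := EMetric.mem_closure_iff.1 hmem ε (pos_iff_ne_zero.2 hε)
  refine ⟨ψ, h1, h2, ?_⟩
  rw [edist_comm, Lp.edist_def] at hlt
  refine (eLpNorm_congr_ae ?_).trans_lt hlt
  filter_upwards [h3, hw.coeFn_toLp] with x hx hx2
  simp [hx, hx2]

/-- Every `w ∈ L²` has a Beurling transform `D ∈ L²`, the limit of `∂ψₙ/∂z` along a sequence
of test functions with `∂ψₙ/∂z̄ → w`. -/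
theorem exists_beurling {w : ℂ → ℂ} (hw : MemLp w 2) :
    ∃ (D : ℂ → ℂ) (ψ : ℕ → ℂ → ℂ), MemLp D 2 ∧
      (∀ n, ContDiff ℝ ∞ (ψ n) ∧ HasCompactSupport (ψ n)) ∧
      Tendsto (fun n => eLpNorm (dzbar (ψ n) - w) 2 volume) atTop (𝓝 0) ∧
      Tendsto (fun n => eLpNorm (dz (ψ n) - D) 2 volume) atTop (𝓝 0) := by
  have hpos : ∀ n : ℕ, ((2 : ℝ≥0∞)⁻¹ ^ (n + 1)) ≠ 0 := fun n =>
    pow_ne_zero _ (ENNReal.inv_ne_zero.2 (by simp))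
  -- With errors below `2⁻⁽ⁿ⁺¹⁾`, two terms of index at least `N` differ by less than `2⁻ᴺ`, a
  -- summable bound; `eLpNorm_dz` carries it from `∂/∂z̄` to `∂/∂z`.
  choose ψ h1 h2 h3 using fun n => exists_dzbar_approx hw (hpos n)
  have hm : ∀ n, MemLp (dz (ψ n)) 2 := fun n =>
    memLp_of_contDiff (contDiff_dz (h1 n)) (hasCompactSupport_dz (h2 n)) 2
  have hmb : ∀ n, MemLp (dzbar (ψ n)) 2 := fun n =>
    memLp_of_contDiff (contDiff_dzbar (h1 n)) (hasCompactSupport_dzbar (h2 n)) 2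
  obtain ⟨D, hD, hlim⟩ := Lp.cauchy_complete_eLpNorm (by norm_num) hm
    (B := fun n => (2 : ℝ≥0∞)⁻¹ ^ n) (by rw [ENNReal.tsum_geometric]; simp) (by
      intro N n m hn hmN
      rw [← dz_sub (h1 n) (h1 m), eLpNorm_dz (ψ := ψ n - ψ m) ((h1 n).sub (h1 m)) ((h2 n).sub (h2 m)),
        dzbar_sub (h1 n) (h1 m)]
      have e : dzbar (ψ n) - dzbar (ψ m) = (dzbar (ψ n) - w) - (dzbar (ψ m) - w) := by simp
      have hle : ∀ k, N ≤ k → eLpNorm (dzbar (ψ k) - w) 2 volume < (2 : ℝ≥0∞)⁻¹ ^ (N + 1) :=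
        fun k hk => (h3 k).trans_le (pow_le_pow_right_of_le_one' (by simp) (by omega))
      rw [e]
      refine (eLpNorm_sub_le ((hmb n).sub hw).1 ((hmb m).sub hw).1 (by norm_num)).trans_lt ?_
      refine (ENNReal.add_lt_add (hle n hn) (hle m hmN)).trans_eq ?_
      rw [pow_succ, ← mul_add, ENNReal.inv_two_add_inv_two, mul_one])
  refine ⟨D, ψ, hD, fun n => ⟨h1 n, h2 n⟩, ?_, hlim⟩
  have ht : Tendsto (fun n : ℕ => (2 : ℝ≥0∞)⁻¹ ^ (n + 1)) atTop (𝓝 0) :=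
    (ENNReal.tendsto_pow_atTop_nhds_zero_of_lt_one (by simp)).comp (tendsto_add_atTop_nat 1)
  exact tendsto_of_tendsto_of_tendsto_of_le_of_le tendsto_const_nhds ht (fun _ => zero_le)
    fun n => (h3 n).le

/-! ### Disc averages and almost everywhere convergence of the truncated integrals. -/

theorem discKernel_eq_indicator (r : ℝ) : discKernel r
    = (Metric.closedBall (0 : ℂ) r).indicator fun _ => (((Real.pi * r ^ 2)⁻¹ : ℝ) : ℂ) := by
  funext z
  by_cases h : ‖z‖ ≤ r
  · rw [discKernel, if_pos h, Set.indicator_of_mem (mem_closedBall_zero_iff.2 h)]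
  · rw [discKernel, if_neg h, Set.indicator_of_notMem (mt mem_closedBall_zero_iff.1 h)]

theorem memLp_discKernel (r : ℝ) (p : ℝ≥0∞) : MemLp (discKernel r) p := by
  rw [discKernel_eq_indicator]
  exact memLp_indicator_const p measurableSet_closedBall _
    (Or.inr (measure_closedBall_lt_top).ne)

theorem volume_real_closedBall {r : ℝ} (hr : 0 < r) (x : ℂ) :
    volume.real (Metric.closedBall x r) = Real.pi * r ^ 2 := by
  rw [measureReal_def, Complex.volume_closedBall]
  simp [hr.le, mul_comm]

theorem integral_discKernel_mul {r : ℝ} (hr : 0 < r) (f : ℂ → ℂ) (x : ℂ) :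
    ∫ y, discKernel r (x - y) * f y = ⨍ y in Metric.closedBall x r, f y := by
  rw [setAverage_eq, volume_real_closedBall hr, ← integral_indicator measurableSet_closedBall,
    ← integral_smul]
  congr 1
  funext y
  by_cases h : ‖x - y‖ ≤ r
  · have h2 : y ∈ Metric.closedBall x r := by rwa [mem_closedBall_iff_norm, norm_sub_rev]
    simp [discKernel, h, h2]
  · have h2 : y ∉ Metric.closedBall x r := by rwa [mem_closedBall_iff_norm, norm_sub_rev]
    rw [Set.indicator_of_notMem h2]
    simp [discKernel, h]

/-- The Lebesgue differentiation theorem. Applied to the Beurling transform, it is the source of the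
almost everywhere existence of principal values. -/
theorem ae_tendsto_discKernel {f : ℂ → ℂ} (hf : LocallyIntegrable f) :
    ∀ᵐ x, Tendsto (fun r => ∫ y, discKernel r (x - y) * f y) (𝓝[>] 0) (𝓝 (f x)) := by
  filter_upwards [IsUnifLocDoublingMeasure.ae_tendsto_average volume hf 1] with x hx
  have h := hx (l := 𝓝[>] (0 : ℝ)) (fun _ => x) (fun r => r) tendsto_id (by
    filter_upwards [self_mem_nhdsWithin] with r hr
    exact Metric.mem_closedBall_self (by simpa using (le_of_lt hr)))
  refine h.congr' ?_
  filter_upwards [self_mem_nhdsWithin] with r hr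
  exact (integral_discKernel_mul hr f x).symm

theorem norm_integral_discKernel_mul_le {r M : ℝ} (hr : 0 < r) {f : ℂ → ℂ} (hM : ∀ y, ‖f y‖ ≤ M)
    (x : ℂ) : ‖∫ y, discKernel r (x - y) * f y‖ ≤ M := by
  rw [integral_discKernel_mul hr, setAverage_eq, norm_smul, norm_inv,
    Real.norm_of_nonneg measureReal_nonneg]
  have h := norm_setIntegral_le_of_norm_le_const (μ := volume) (s := Metric.closedBall x r)
    measure_closedBall_lt_top (fun y _ => hM y)
  rw [volume_real_closedBall hr] at h ⊢
  rw [inv_mul_le_iff₀ (by positivity), mul_comm]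
  exact h

theorem tendsto_integral_mul_of_eLpNorm {k f : ℂ → ℂ} {F : ℕ → ℂ → ℂ} (hk : MemLp k 2)
    (hF : ∀ n, MemLp (F n) 2) (hf : MemLp f 2)
    (h : Tendsto (fun n => eLpNorm (F n - f) 2 volume) atTop (𝓝 0)) :
    Tendsto (fun n => ∫ y, k y * F n y) atTop (𝓝 (∫ y, k y * f y)) := by
  rw [tendsto_iff_edist_tendsto_0]
  have h2 := ENNReal.Tendsto.const_mul (a := eLpNorm k 2 volume) h (Or.inr hk.eLpNorm_ne_top)
  rw [mul_zero] at h2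
  refine tendsto_of_tendsto_of_tendsto_of_le_of_le tendsto_const_nhds h2 (fun _ => zero_le)
    fun n => ?_
  have e : (∫ y, k y * F n y) - ∫ y, k y * f y = ∫ y, k y * (F n - f) y := by
    simp only [Pi.sub_apply, mul_sub]
    exact (integral_sub (hk.integrable_mul (hF n)) (hk.integrable_mul hf)).symm
  rw [edist_eq_enorm_sub, e]
  exact enorm_integral_mul_le hk.1 ((hF n).sub hf).1

theorem memLp_comp_sub_left {k : ℂ → ℂ} {p : ℝ≥0∞} (hk : MemLp k p) (x : ℂ) :
    MemLp (fun y => k (x - y)) p :=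
  hk.comp_measurePreserving (Measure.measurePreserving_sub_left volume x)

/-- The truncated singular integrals of `w` are the disc averages of its Beurling transform. -/
theorem exists_truncKernel_eq_discKernel {w : ℂ → ℂ} (hw : MemLp w 2) :
    ∃ D : ℂ → ℂ, MemLp D 2 ∧ ∀ r, 0 < r → ∀ x,
      ∫ y, truncKernel r (x - y) * w y = ∫ y, discKernel r (x - y) * D y := by
  obtain ⟨D, ψ, hD, hψ, h1, h2⟩ := exists_beurling hw
  refine ⟨D, hD, fun r hr x => ?_⟩
  have t1 := tendsto_integral_mul_of_eLpNorm (memLp_comp_sub_left (memLp_two_truncKernel hr) x)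
    (fun n => memLp_of_contDiff (contDiff_dzbar (hψ n).1) (hasCompactSupport_dzbar (hψ n).2) 2)
    hw h1
  have t2 := tendsto_integral_mul_of_eLpNorm (memLp_comp_sub_left (memLp_discKernel r 2) x)
    (fun n => memLp_of_contDiff (contDiff_dz (hψ n).1) (hasCompactSupport_dz (hψ n).2) 2)
    hD h2
  -- The identity holds along `ψ n`, and both sides converge because both kernels are in `L²`.
  simp only [fun n => truncKernel_conv_dzbar hr (hψ n).1 (hψ n).2 x] at t1
  exact tendsto_nhds_unique t1 t2

/-! ### Weak derivatives of the Cauchy transform. -/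

/-- Fubini for a bounded convolution kernel. -/
theorem integral_mul_integral_kernel_swap {k a b : ℂ → ℂ} {M : ℝ} (hk : Measurable k)
    (hM : ∀ z, ‖k z‖ ≤ M) (ha : Integrable a) (hb : Integrable b) :
    ∫ x, a x * ∫ y, k (x - y) * b y = ∫ y, b y * ∫ x, k (x - y) * a x := by
  have hint : Integrable (fun p : ℂ × ℂ => k (p.1 - p.2) * (a p.1 * b p.2))
      (volume.prod volume) :=
    (ha.mul_prod hb).bdd_mul (hk.comp (measurable_fst.sub measurable_snd)).aestronglyMeasurable
      (Eventually.of_forall fun p => hM _)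
  have h := integral_integral_swap (f := fun x y => k (x - y) * (a x * b y)) hint
  simp only [← integral_const_mul]
  have e1 : ∀ x y, a x * (k (x - y) * b y) = k (x - y) * (a x * b y) := fun x y => by ring
  have e2 : ∀ x y, b y * (k (x - y) * a x) = k (x - y) * (a x * b y) := fun x y => by ring
  simp only [e1, e2]
  exact h

theorem integral_mul_comm_neg {k a : ℂ → ℂ} (c : ℂ → ℂ) (y : ℂ)
    (h : ∀ z, k (-z) = c z) : ∫ x, k (x - y) * a x = ∫ x, c (y - x) * a x := by
  congr 1
  funext x
  rw [← h, neg_sub]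

/-- Disc averages of `φ` are bounded by any bound for `φ` and converge to it almost everywhere, so
dominated convergence applies. -/
theorem tendsto_integral_mul_discKernel {b φ : ℂ → ℂ} (hb : Integrable b) (hφ : ContDiff ℝ ∞ φ)
    (hc : HasCompactSupport φ) :
    Tendsto (fun r => ∫ y, b y * ∫ x, discKernel r (y - x) * φ x) (𝓝[>] 0)
      (𝓝 (∫ y, b y * φ y)) := by
  obtain ⟨M, hM⟩ := hφ.continuous.bounded_above_of_compact_support hc
  apply tendsto_integral_filter_of_dominated_convergence (fun y => ‖b y‖ * M)
  · refine Eventually.of_forall fun r => hb.1.mul ?_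
    have : AEStronglyMeasurable (fun p : ℂ × ℂ => discKernel r (p.1 - p.2) * φ p.2)
        (volume.prod volume) :=
      ((measurable_discKernel r).comp (measurable_fst.sub measurable_snd)).aestronglyMeasurable.mul
        (hφ.continuous.comp continuous_snd).aestronglyMeasurable
    exact this.integral_prod_right'
  · filter_upwards [self_mem_nhdsWithin] with r hr
    refine Eventually.of_forall fun y => ?_
    rw [norm_mul]
    gcongr
    exact norm_integral_discKernel_mul_le hr hM y
  · exact hb.norm.mul_const M
  · filter_upwards [ae_tendsto_discKernel (hφ.continuous.locallyIntegrable (μ := volume))]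
      with y hy
    exact hy.const_mul _

/-- The Cauchy transform of `w`. -/
def cauchyTransform (w : ℂ → ℂ) (x : ℂ) : ℂ := ∫ y, cauchyKernel (x - y) * w y

/-- Convolution integrands with a locally integrable kernel, localized in both variables. -/
theorem integrable_mul_kernel_mul {k a w : ℂ → ℂ} {A R M : ℝ} (hk : LocallyIntegrable k)
    (ha : AEStronglyMeasurable a) (hM : ∀ x, ‖a x‖ ≤ M) (haR : ∀ x, A < ‖x‖ → a x = 0)
    (hw : Integrable w) (hwR : ∀ x, R < ‖x‖ → w x = 0) :
    Integrable (fun p : ℂ × ℂ => a p.1 * (k (p.1 - p.2) * w p.2)) (volume.prod volume) := by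
  -- The supports of `a` and `w` confine `x - y` to this disc, so cutting the kernel off there makes
  -- it integrable without changing the integrand.
  set K := (Metric.closedBall (0 : ℂ) (A + R)).indicator k with hK
  have hKi : Integrable K := by
    rw [hK, integrable_indicator_iff measurableSet_closedBall]
    exact hk.integrableOn_isCompact (isCompact_closedBall _ _)
  have h1 := hw.convolution_integrand (ContinuousLinearMap.mul ℝ ℂ) hKi
  have h2 := h1.bdd_mul (f := fun p : ℂ × ℂ => a p.1) (c := M) ha.comp_fst
    (Eventually.of_forall fun p => hM _)
  refine h2.congr (Eventually.of_forall fun p => ?_)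
  simp only [ContinuousLinearMap.mul_apply']
  by_cases hp : A < ‖p.1‖
  · simp [haR _ hp]
  by_cases hp2 : R < ‖p.2‖
  · simp [hwR _ hp2]
  have : p.1 - p.2 ∈ Metric.closedBall (0 : ℂ) (A + R) := by
    rw [mem_closedBall_zero_iff]
    exact (norm_sub_le _ _).trans (add_le_add (not_lt.1 hp) (not_lt.1 hp2))
  rw [hK, Set.indicator_of_mem this, mul_comm (w p.2)]

theorem HasCompactSupport.exists_forall_norm_lt {f : ℂ → ℂ} (hc : HasCompactSupport f) :
    ∃ R, 0 < R ∧ ∀ x, R < ‖x‖ → f x = 0 := by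
  obtain ⟨R, h0, hR⟩ := hc.isBounded.exists_pos_norm_le
  refine ⟨R, h0, fun x hx => ?_⟩
  by_contra hne
  exact absurd (hR x (subset_tsupport _ hne)) (not_le.2 hx)

/-- Pairing the Cauchy transform with a test function, as a limit of pairings with the
regularized kernels. -/
theorem tendsto_regKernel_pairing {w a : ℂ → ℂ} (hw : Integrable w) (hwc : HasCompactSupport w)
    (ha : ContDiff ℝ ∞ a) (hac : HasCompactSupport a) :
    Tendsto (fun r => -∫ y, w y * ∫ x, regKernel r (y - x) * a x) (𝓝[>] 0)
      (𝓝 (∫ x, cauchyTransform w x * a x)) := by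
  obtain ⟨A, -, hA⟩ := HasCompactSupport.exists_forall_norm_lt hac
  obtain ⟨R, -, hR⟩ := HasCompactSupport.exists_forall_norm_lt hwc
  obtain ⟨M, hM⟩ := ha.continuous.bounded_above_of_compact_support hac
  have hint := integrable_mul_kernel_mul locallyIntegrable_cauchyKernel
    ha.continuous.aestronglyMeasurable hM hA hw hR
  have e0 : ∫ x, cauchyTransform w x * a x
      = ∫ p : ℂ × ℂ, a p.1 * (cauchyKernel (p.1 - p.2) * w p.2) ∂(volume.prod volume) := by
    rw [integral_prod _ hint]
    simp only [integral_const_mul, cauchyTransform, mul_comm]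
  -- The minus sign comes from oddness of `regKernel` when Fubini exchanges the roles of `x` and
  -- `y`.
  have e1 : ∀ r, 0 < r → -∫ y, w y * ∫ x, regKernel r (y - x) * a x
      = ∫ p : ℂ × ℂ, a p.1 * (regKernel r (p.1 - p.2) * w p.2) ∂(volume.prod volume) := by
    intro r hr
    have hmeas : Measurable (regKernel r) := (lipschitzWith_regKernel hr).continuous.measurable
    have hi : Integrable (fun p : ℂ × ℂ => a p.1 * (regKernel r (p.1 - p.2) * w p.2))
        (volume.prod volume) := by
      refine hint.mono ?_ (Eventually.of_forall fun p => ?_)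
      · exact ha.continuous.aestronglyMeasurable.comp_fst.mul
          ((hmeas.comp (measurable_fst.sub measurable_snd)).aestronglyMeasurable.mul
            hw.1.comp_snd)
      · simp only [norm_mul]
        gcongr
        exact norm_regKernel_le hr _
    rw [integral_prod _ hi]
    simp only [integral_const_mul]
    rw [integral_mul_integral_kernel_swap hmeas (norm_regKernel_le_inv hr)
      (integrable_of_contDiff ha hac) hw, ← integral_neg]
    congr 1
    funext y
    rw [integral_mul_comm_neg (fun z => -regKernel r z) y (regKernel_neg r)]
    simp only [neg_mul, integral_neg, mul_neg]
  rw [e0]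
  refine Tendsto.congr' (f₁ := fun r => ∫ p : ℂ × ℂ, a p.1 * (regKernel r (p.1 - p.2) * w p.2)
    ∂(volume.prod volume)) ?_ ?_
  · filter_upwards [self_mem_nhdsWithin] with r hr using (e1 r hr).symm
  apply tendsto_integral_filter_of_dominated_convergence
    (fun p : ℂ × ℂ => ‖a p.1 * (cauchyKernel (p.1 - p.2) * w p.2)‖)
  · filter_upwards [self_mem_nhdsWithin] with r hr
    exact ha.continuous.aestronglyMeasurable.comp_fst.mul
      (((lipschitzWith_regKernel hr).continuous.measurable.comp
        (measurable_fst.sub measurable_snd)).aestronglyMeasurable.mul hw.1.comp_snd)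
  · filter_upwards [self_mem_nhdsWithin] with r hr
    refine Eventually.of_forall fun p => ?_
    simp only [norm_mul]
    gcongr
    exact norm_regKernel_le hr _
  · exact hint.norm
  · have hae : ∀ᵐ p : ℂ × ℂ ∂(volume.prod volume), p.1 - p.2 ≠ 0 := by
      have hms : MeasurableSet {p : ℂ × ℂ | p.1 - p.2 ≠ 0} :=
        ((measurable_fst.sub measurable_snd) (measurableSet_singleton 0)).compl
      rw [Measure.ae_prod_iff_ae_ae hms]
      refine Eventually.of_forall fun x => ?_
      filter_upwards [Measure.ae_ne volume x] with y hy
      exact sub_ne_zero.2 hy.symm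
    filter_upwards [hae] with p hp
    exact ((tendsto_regKernel hp).mul_const _).const_mul _

/-- `∂/∂z̄` of the Cauchy transform of `w` is `w`. -/
theorem cauchyTransform_dzbar {w φ : ℂ → ℂ} (hw : Integrable w) (hwc : HasCompactSupport w)
    (hφ : ContDiff ℝ ∞ φ) (hc : HasCompactSupport φ) :
    ∫ x, cauchyTransform w x * dzbar φ x = -∫ x, w x * φ x := by
  refine tendsto_nhds_unique (tendsto_regKernel_pairing hw hwc (contDiff_dzbar hφ)
    (hasCompactSupport_dzbar hc)) ?_
  refine (tendsto_integral_mul_discKernel hw hφ hc).neg.congr' ?_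
  filter_upwards [self_mem_nhdsWithin] with r hr
  simp only [discKernel_conv hr hφ hc]

/-- `∂/∂z` of the Cauchy transform of `w` is the Beurling transform of `w`. -/
theorem cauchyTransform_dz {w D φ : ℂ → ℂ} (hw : Integrable w) (hwc : HasCompactSupport w)
    (hD : LocallyIntegrable D)
    (hwD : ∀ r, 0 < r → ∀ x,
      ∫ y, truncKernel r (x - y) * w y = ∫ y, discKernel r (x - y) * D y)
    (hφ : ContDiff ℝ ∞ φ) (hc : HasCompactSupport φ) :
    ∫ x, cauchyTransform w x * dz φ x = -∫ x, D x * φ x := by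
  obtain ⟨A, hA0, hA⟩ := HasCompactSupport.exists_forall_norm_lt hc
  -- Fubini needs an integrable function. For `r < 1` this cutoff does not change the disc averages
  -- at points of the support of `φ`.
  set D' := (Metric.closedBall (0 : ℂ) (A + 1)).indicator D with hD'
  have hDi : Integrable D' := by
    rw [hD', integrable_indicator_iff measurableSet_closedBall]
    exact hD.integrableOn_isCompact (isCompact_closedBall _ _)
  have hφi := integrable_of_contDiff hφ hc
  have e0 : ∫ x, D x * φ x = ∫ x, D' x * φ x := by
    congr 1
    funext x
    by_cases hx : x ∈ Metric.closedBall (0 : ℂ) (A + 1)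
    · rw [hD', Set.indicator_of_mem hx]
    · rw [mem_closedBall_zero_iff] at hx
      rw [hA x (by linarith)]
      simp
  refine tendsto_nhds_unique (tendsto_regKernel_pairing hw hwc (contDiff_dz hφ)
    (hasCompactSupport_dz hc)) ?_
  rw [e0]
  refine (tendsto_integral_mul_discKernel hDi hφ hc).neg.congr' ?_
  filter_upwards [Ioo_mem_nhdsGT one_pos] with r hr
  have hr0 : 0 < r := hr.1
  simp only [← truncKernel_conv hr0 hφ hc]
  congr 1
  -- Fubini puts both kernels back on `D'` and `w`, where `hwD` identifies the results.
  have s1 := integral_mul_integral_kernel_swap (measurable_discKernel r)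
    (norm_discKernel_le r) hφi hDi
  have s2 := integral_mul_integral_kernel_swap (measurable_truncKernel r)
    (norm_truncKernel_le hr0) hφi hw
  simp only [fun y => integral_mul_comm_neg (a := φ) (discKernel r) y (discKernel_neg r)] at s1
  simp only [fun y => integral_mul_comm_neg (a := φ) (truncKernel r) y (truncKernel_neg r)] at s2
  rw [← s1, ← s2]
  congr 1
  funext x
  rw [hwD r hr0]
  by_cases hx : A < ‖x‖
  · rw [hA x hx, zero_mul, zero_mul]
  congr 2
  funext y
  by_cases hy : y ∈ Metric.closedBall (0 : ℂ) (A + 1)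
  · rw [hD', Set.indicator_of_mem hy]
  · rw [mem_closedBall_zero_iff] at hy
    have : ¬ ‖x - y‖ ≤ r := by
      intro h
      have h1 : ‖y‖ ≤ ‖x‖ + ‖x - y‖ := by
        have := norm_sub_le x (x - y)
        simpa using this
      linarith [hr.2]
    simp [discKernel, this]

/-- Passage to Cartesian derivatives: `∂₁ = ∂/∂z + ∂/∂z̄` and `∂₂ = i(∂/∂z - ∂/∂z̄)`. -/
theorem integral_cauchyTransform_fderiv {w D φ : ℂ → ℂ} (hw : Integrable w)
    (hwc : HasCompactSupport w) (hD : LocallyIntegrable D)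
    (hwD : ∀ r, 0 < r → ∀ x,
      ∫ y, truncKernel r (x - y) * w y = ∫ y, discKernel r (x - y) * D y)
    (hF : LocallyIntegrable (cauchyTransform w))
    (hφ : ContDiff ℝ ∞ φ) (hc : HasCompactSupport φ) :
    ∫ x, cauchyTransform w x * fderiv ℝ φ x 1 = -∫ x, (D x + w x) * φ x ∧
      ∫ x, cauchyTransform w x * fderiv ℝ φ x Complex.I
        = -∫ x, Complex.I * (D x - w x) * φ x := by
  have hint : ∀ {f g : ℂ → ℂ}, LocallyIntegrable f → ContDiff ℝ ∞ g → HasCompactSupport g →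
      Integrable (fun x => f x * g x) := fun hf hg hgc =>
    by simpa [mul_comm] using hf.integrable_smul_left_of_hasCompactSupport hg.continuous hgc
  have hFz := hint hF (contDiff_dz hφ) (hasCompactSupport_dz hc)
  have hFb := hint hF (contDiff_dzbar hφ) (hasCompactSupport_dzbar hc)
  have hDφ := hint hD hφ hc
  have hwφ := hint hw.locallyIntegrable hφ hc
  have h1 := cauchyTransform_dz hw hwc hD hwD hφ hc
  have h2 := cauchyTransform_dzbar hw hwc hφ hc
  constructor
  · simp only [(fderiv_apply_eq_dz_dzbar φ _).1, mul_add, add_mul]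
    rw [integral_add hFz hFb, integral_add hDφ hwφ, h1, h2]
    ring
  · have e1 : ∀ x, cauchyTransform w x * fderiv ℝ φ x Complex.I = Complex.I *
        (cauchyTransform w x * dz φ x - cauchyTransform w x * dzbar φ x) := by
      intro x; rw [(fderiv_apply_eq_dz_dzbar φ _).2]; ring
    have e2 : ∀ x, Complex.I * (D x - w x) * φ x = Complex.I * (D x * φ x - w x * φ x) := by
      intro x; ring
    rw [funext e1, funext e2, integral_const_mul, integral_const_mul, integral_sub hFz hFb,
      integral_sub hDφ hwφ, h1, h2]
    ring

/-! ### The periodic kernel as finitely many Cauchy kernels plus a holomorphic remainder. -/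

/-- The periodic Cauchy kernel `½ cot (π z)`. -/
def perKernel (z : ℂ) : ℂ := Complex.cot ((Real.pi : ℂ) * z) / 2

/-- The part of the Mittag-Leffler series of the cotangent with poles of modulus larger
than `N`. -/
def cotTail (N : ℕ) (z : ℂ) : ℂ := ∑' n : ℕ, cotTerm z (n + N)

/-- With `m = n + N + 1 ≥ 2R`, both poles `±m` are at distance at least `m/2` from `z`, and the
paired term is `2z/((z - m)(z + m))`, of order `m⁻²`. This gives uniform convergence of the tail. -/
theorem norm_cotTerm_le {R : ℝ} (hR : 0 < R) {N : ℕ} (hN : 2 * R ≤ N) {z : ℂ} (hz : ‖z‖ < R)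
    (n : ℕ) : z - ((n + N : ℕ) + 1) ≠ 0 ∧ z + ((n + N : ℕ) + 1) ≠ 0 ∧
      ‖cotTerm z (n + N)‖ ≤ 8 * R * ((n + 1 : ℝ) ^ 2)⁻¹ := by
  set m : ℂ := ((n + N : ℕ) : ℂ) + 1 with hm
  set t : ℝ := ((n + N : ℕ) : ℝ) + 1 with ht
  have hmt : ‖m‖ = t := by
    have : m = ((n + N + 1 : ℕ) : ℂ) := by rw [hm]; push_cast; ring
    rw [this, Complex.norm_natCast, ht]; push_cast; ring
  have htn : (n : ℝ) + 1 ≤ t := by rw [ht]; push_cast; linarith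
  have htR : 2 * R ≤ t := by
    rw [ht]; push_cast
    have : (0 : ℝ) ≤ n := n.cast_nonneg
    linarith
  have h1 : t / 2 ≤ ‖z - m‖ := by
    have := norm_sub_norm_le m z
    rw [norm_sub_rev, hmt] at this
    linarith
  have h2 : t / 2 ≤ ‖z + m‖ := by
    have := norm_sub_norm_le m (-z)
    rw [norm_neg, hmt, sub_neg_eq_add, add_comm] at this
    linarith
  have ht0 : 0 < t := by linarith
  have e1 : z - m ≠ 0 := norm_pos_iff.1 (by linarith)
  have e2 : z + m ≠ 0 := norm_pos_iff.1 (by linarith)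
  refine ⟨e1, e2, ?_⟩
  have e3 : cotTerm z (n + N) = 2 * z / ((z - m) * (z + m)) := by
    rw [cotTerm, ← hm]
    field_simp
    ring
  rw [e3, norm_div, norm_mul, norm_mul, Complex.norm_ofNat]
  calc 2 * ‖z‖ / (‖z - m‖ * ‖z + m‖) ≤ 2 * R / ((t / 2) * (t / 2)) := by gcongr
    _ = 8 * R * (t ^ 2)⁻¹ := by field_simp; norm_num
    _ ≤ 8 * R * ((n + 1 : ℝ) ^ 2)⁻¹ := by gcongr

theorem differentiableOn_cotTail {R : ℝ} (hR : 0 < R) {N : ℕ} (hN : 2 * R ≤ N) :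
    DifferentiableOn ℂ (cotTail N) (Metric.ball 0 R) := by
  have hs : Summable fun n : ℕ => 8 * R * ((n + 1 : ℝ) ^ 2)⁻¹ := by
    apply Summable.mul_left
    have := (summable_nat_add_iff 1).2 (Real.summable_nat_pow_inv.2 (one_lt_two))
    simpa using this
  refine Complex.differentiableOn_tsum_of_summable_norm hs (fun n => ?_) Metric.isOpen_ball
    fun n z hz => (norm_cotTerm_le hR hN (mem_ball_zero_iff.1 hz) n).2.2
  intro z hz
  obtain ⟨h1, h2, -⟩ := norm_cotTerm_le hR hN (mem_ball_zero_iff.1 hz) n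
  apply DifferentiableAt.differentiableWithinAt
  simp only [cotTerm]
  exact ((differentiableAt_const (1 : ℂ)).fun_div (differentiableAt_id.sub_const _) h1).fun_add
    ((differentiableAt_const (1 : ℂ)).fun_div (differentiableAt_id.add_const _) h2)

theorem sum_Icc_cauchyKernel (N : ℕ) (z : ℂ) :
    ∑ n ∈ Finset.Icc (-(N : ℤ)) N, cauchyKernel (z - n)
      = (Real.pi : ℂ)⁻¹ * (1 / z + ∑ j ∈ Finset.range N, cotTerm z j) := by
  induction N with
  | zero => simp [cauchyKernel]; ring
  | succ N ih =>
    rw [Nat.cast_add, Nat.cast_one, Finset.Icc_succ_succ,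
      Finset.sum_union (by simp), Finset.sum_pair (by lia), ih, Finset.sum_range_succ]
    simp only [cauchyKernel, cotTerm, mul_inv]
    push_cast
    ring

theorem perKernel_eq (N : ℕ) {z : ℂ} (hz : z ∈ Complex.integerComplement) :
    perKernel z = (1 / 2 : ℂ) * ∑ n ∈ Finset.Icc (-(N : ℤ)) N, cauchyKernel (z - n)
      + (2 * Real.pi : ℂ)⁻¹ * cotTail N z := by
  have h := cot_series_rep' hz
  have h2 := (summable_cotTerm hz).sum_add_tsum_nat_add N
  rw [sum_Icc_cauchyKernel, cotTail]
  have hpi : (Real.pi : ℂ) ≠ 0 := by exact_mod_cast Real.pi_ne_zero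
  have h3 : Complex.cot (Real.pi * z) = (Real.pi : ℂ)⁻¹ * (1 / z
      + (∑ j ∈ Finset.range N, cotTerm z j + ∑' n : ℕ, cotTerm z (n + N))) := by
    rw [h2, eq_inv_mul_iff_mul_eq₀ hpi, ← sub_eq_iff_eq_add']
    exact h
  rw [perKernel, h3]
  field_simp
  ring

/-- Since `4R ≤ N`, the cotangent tail is holomorphic on the disc of radius `2R`. A bump equal to
`1` up to radius `R` and supported up to `3R/2` makes it globally smooth, so that it can be
convolved with `w`. -/
theorem exists_perKernel_decomposition {R : ℝ} (hR : 0 < R) {N : ℕ} (hN : 4 * R ≤ N) :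
    ∃ H : ℂ → ℂ, ContDiff ℝ ∞ H ∧ HasCompactSupport H ∧
      (∀ z, ‖z‖ < R → DifferentiableAt ℂ H z) ∧
      ∀ z, ‖z‖ < R → z ∈ Complex.integerComplement →
        perKernel z = (1 / 2 : ℂ) * ∑ n ∈ Finset.Icc (-(N : ℤ)) N, cauchyKernel (z - n) + H z := by
  have hd := differentiableOn_cotTail (R := 2 * R) (by positivity) (N := N) (by linarith)
  let b : ContDiffBump (0 : ℂ) := ⟨R, 3 / 2 * R, hR, by linarith⟩
  have hone : ∀ z, ‖z‖ < R → b z = 1 := fun z hz =>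
    b.one_of_mem_closedBall (mem_closedBall_zero_iff.2 hz.le)
  set H : ℂ → ℂ := fun z => (b z : ℝ) • ((2 * Real.pi : ℂ)⁻¹ * cotTail N z) with hH
  have heq : ∀ z, ‖z‖ < R → H z = (2 * Real.pi : ℂ)⁻¹ * cotTail N z := fun z hz => by
    simp only [hH, hone z hz, one_smul]
  refine ⟨H, ?_, ?_, ?_, ?_⟩
  · rw [contDiff_iff_contDiffAt]
    intro z
    by_cases hz : z ∈ tsupport H
    swap
    · exact contDiffAt_const.congr_of_eventuallyEq (notMem_tsupport_iff_eventuallyEq.1 hz)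
    have hz2 : z ∈ Metric.ball (0 : ℂ) (2 * R) := by
      have := tsupport_smul_subset_left (fun z => (b z : ℝ))
        (fun z => (2 * Real.pi : ℂ)⁻¹ * cotTail N z) hz
      rw [b.tsupport_eq, mem_closedBall_zero_iff] at this
      rw [mem_ball_zero_iff]
      change _ ≤ 3 / 2 * R at this
      linarith
    have h1 : ContDiffAt ℂ ∞ (cotTail N) z :=
      (hd.contDiffOn Metric.isOpen_ball).contDiffAt (Metric.isOpen_ball.mem_nhds hz2)
    exact b.contDiff.contDiffAt.smul (contDiffAt_const.mul (h1.restrict_scalars ℝ))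
  · exact b.hasCompactSupport.smul_right
  · intro z hz
    have hz2 : z ∈ Metric.ball (0 : ℂ) (2 * R) := by
      rw [mem_ball_zero_iff]; linarith
    have h1 := (hd.differentiableAt (Metric.isOpen_ball.mem_nhds hz2)).const_mul
      ((2 * Real.pi : ℂ)⁻¹)
    refine h1.congr_of_eventuallyEq ?_
    filter_upwards [(continuous_norm.tendsto z).eventually (gt_mem_nhds hz)] with y hy
    exact heq y hy
  · intro z hz hz2
    rw [perKernel_eq N hz2, heq z hz]

theorem hasDerivAt_perKernel {z : ℂ} (hz : z ∈ Complex.integerComplement) :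
    HasDerivAt perKernel (-(Real.pi / 2) * (Complex.sin (Real.pi * z) ^ 2)⁻¹) z := by
  have hs := sin_pi_mul_ne_zero hz
  have h1 : HasDerivAt (fun z : ℂ => Real.pi * z) (Real.pi : ℂ) z := by
    simpa using (hasDerivAt_id z).const_mul (Real.pi : ℂ)
  have h2 := (((Complex.hasDerivAt_cos _).comp z h1).div
    ((Complex.hasDerivAt_sin _).comp z h1) hs).div_const 2
  have e : -(Real.pi / 2) * (Complex.sin (Real.pi * z) ^ 2)⁻¹
      = (-Complex.sin (Real.pi * z) * Real.pi * Complex.sin (Real.pi * z)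
        - Complex.cos (Real.pi * z) * (Complex.cos (Real.pi * z) * Real.pi))
        / Complex.sin (Real.pi * z) ^ 2 / 2 := by
    have := Complex.sin_sq_add_cos_sq (Real.pi * z)
    field_simp
    linear_combination this
  rw [e]
  exact h2

theorem sub_intCast_ne_zero_of_mem {z : ℂ} (hz : z ∈ Complex.integerComplement) (n : ℤ) :
    z - n ≠ 0 := by
  intro h
  exact hz ⟨n, (sub_eq_zero.1 h).symm⟩

theorem deriv_perKernel_eq {R : ℝ} {N : ℕ} {H : ℂ → ℂ}
    (hd : ∀ z, ‖z‖ < R → DifferentiableAt ℂ H z)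
    (h : ∀ z, ‖z‖ < R → z ∈ Complex.integerComplement →
        perKernel z = (1 / 2 : ℂ) * ∑ n ∈ Finset.Icc (-(N : ℤ)) N, cauchyKernel (z - n) + H z)
    {z : ℂ} (hz : ‖z‖ < R) (hz2 : z ∈ Complex.integerComplement) :
    deriv perKernel z = (1 / 2 : ℂ) * ∑ n ∈ Finset.Icc (-(N : ℤ)) N,
      -((Real.pi : ℂ) * (z - n) ^ 2)⁻¹ + fderiv ℝ H z 1 := by
  have e : perKernel =ᶠ[𝓝 z] fun z =>
      (1 / 2 : ℂ) * ∑ n ∈ Finset.Icc (-(N : ℤ)) N, cauchyKernel (z - n) + H z := by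
    filter_upwards [(continuous_norm.tendsto z).eventually (gt_mem_nhds hz),
      Complex.isOpen_compl_range_intCast.mem_nhds hz2] with y hy hy2
    exact h y hy hy2
  have h1 : HasDerivAt (fun z : ℂ => ∑ n ∈ Finset.Icc (-(N : ℤ)) N, cauchyKernel (z - n))
      (∑ n ∈ Finset.Icc (-(N : ℤ)) N, -((Real.pi : ℂ) * (z - n) ^ 2)⁻¹) z :=
    HasDerivAt.fun_sum fun n _ =>
      (hasDerivAt_cauchyKernel (sub_intCast_ne_zero_of_mem hz2 n)).comp_sub_const z (n : ℂ)
  have h2 := (h1.const_mul (1 / 2 : ℂ)).add (hd z hz).hasDerivAt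
  rw [e.deriv_eq]
  refine h2.deriv.trans ?_
  congr 1
  have h3 := ((hd z hz).hasDerivAt.hasFDerivAt.restrictScalars ℝ).fderiv
  rw [h3]
  simp

theorem fderiv_I_of_differentiableAt {H : ℂ → ℂ} {z : ℂ} (hd : DifferentiableAt ℂ H z) :
    fderiv ℝ H z Complex.I = Complex.I * fderiv ℝ H z 1 := by
  simpa using (differentiableAt_complex_iff_differentiableAt_real.1 hd).2

/-! ### Local integrability, and truncation around all lattice translates. -/

theorem memLp_of_memLp_top {w : ℂ → ℂ} (hw : MemLp w ∞) (hwc : HasCompactSupport w) (p : ℝ≥0∞) :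
    MemLp w p :=
  hw.mono_exponent_of_measure_support_ne_top (s := tsupport w)
    (fun _ hx => image_eq_zero_of_notMem_tsupport hx) hwc.measure_lt_top.ne le_top

theorem exists_ae_norm_le {w : ℂ → ℂ} (hw : MemLp w ∞) : ∃ M, 0 ≤ M ∧ ∀ᵐ x, ‖w x‖ ≤ M := by
  refine ⟨(eLpNorm w ∞ volume).toReal, ENNReal.toReal_nonneg, ?_⟩
  filter_upwards [enorm_ae_le_eLpNormEssSup w volume] with x hx
  rw [← toReal_enorm]
  exact ENNReal.toReal_mono hw.eLpNorm_ne_top (by rwa [eLpNorm_exponent_top])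

theorem integrable_kernel_mul {k w : ℂ → ℂ} (hk : LocallyIntegrable k) (hw : MemLp w ∞)
    (hwc : HasCompactSupport w) (x : ℂ) : Integrable (fun y => k (x - y) * w y) := by
  obtain ⟨R, -, hR⟩ := HasCompactSupport.exists_forall_norm_lt hwc
  obtain ⟨M, -, hM⟩ := exists_ae_norm_le hw
  set K := (Metric.closedBall (0 : ℂ) (‖x‖ + R)).indicator k with hK
  have hKi : Integrable K := by
    rw [hK, integrable_indicator_iff measurableSet_closedBall]
    exact hk.integrableOn_isCompact (isCompact_closedBall _ _)
  refine ((hKi.comp_sub_left x).mul_bdd hw.1 hM).congr (Eventually.of_forall fun y => ?_)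
  by_cases hy : R < ‖y‖
  · simp [hR y hy]
  have : x - y ∈ Metric.closedBall (0 : ℂ) (‖x‖ + R) := by
    rw [mem_closedBall_zero_iff]
    exact (norm_sub_le _ _).trans (by linarith)
  simp only [hK, Set.indicator_of_mem this]

theorem locallyIntegrable_of_forall_ball {f : ℂ → ℂ}
    (h : ∀ A, 0 < A → IntegrableOn f (Metric.ball 0 A)) : LocallyIntegrable f := fun x =>
  ⟨Metric.ball 0 (‖x‖ + 1), Metric.isOpen_ball.mem_nhds (by simp), h _ (by positivity)⟩

theorem locallyIntegrable_cauchyTransform {w : ℂ → ℂ} (hw : Integrable w)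
    (hwc : HasCompactSupport w) : LocallyIntegrable (cauchyTransform w) := by
  refine locallyIntegrable_of_forall_ball fun A _ => ?_
  obtain ⟨R, -, hR⟩ := HasCompactSupport.exists_forall_norm_lt hwc
  rw [← integrable_indicator_iff Metric.isOpen_ball.measurableSet]
  set a : ℂ → ℂ := (Metric.ball (0 : ℂ) A).indicator fun _ => 1 with ha
  have h := integrable_mul_kernel_mul (A := A) (M := 1) locallyIntegrable_cauchyKernel
    (a := a) (aestronglyMeasurable_const.indicator Metric.isOpen_ball.measurableSet)
    (fun x => by
      refine (norm_indicator_le_norm_self _ _).trans ?_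
      simp)
    (fun x hx => Set.indicator_of_notMem (by simpa using hx.le) _) hw hR
  refine h.integral_prod_left.congr (Eventually.of_forall fun x => ?_)
  simp only [integral_const_mul]
  by_cases hx : x ∈ Metric.ball (0 : ℂ) A
  · simp only [ha, Set.indicator_of_mem hx, one_mul, cauchyTransform]
  · simp only [ha, Set.indicator_of_notMem hx, zero_mul]

/-- The `r`-neighbourhood of `x + ℤ`. -/
def cBalls (x : ℂ) (r : ℝ) : Set ℂ := ⋃ n : ℤ, Metric.ball (x + n) r

theorem measurableSet_cBalls (x : ℂ) (r : ℝ) : MeasurableSet (cBalls x r) :=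
  (isOpen_iUnion fun _ => Metric.isOpen_ball).measurableSet

theorem ae_sub_mem_integerComplement (x : ℂ) : ∀ᵐ y : ℂ, x - y ∈ Complex.integerComplement := by
  have hc : (Set.range fun n : ℤ => x - n).Countable := Set.countable_range _
  filter_upwards [hc.ae_notMem volume] with y hy
  rintro ⟨n, hn⟩
  exact hy ⟨n, by simp [hn]⟩

/-- Almost every `y` has positive distance from `x + ℤ` and leaves the discs once `r` is small, so
dominated convergence applies even though `f` varies with `r`. -/
theorem tendsto_setIntegral_cBalls {f : ℝ → ℂ → ℂ} {b : ℂ → ℝ} (x : ℂ) (hb : Integrable b)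
    (hm : ∀ᶠ r in 𝓝[>] (0 : ℝ), AEStronglyMeasurable (f r))
    (hle : ∀ᶠ r in 𝓝[>] (0 : ℝ), ∀ᵐ y, y ∈ cBalls x r → ‖f r y‖ ≤ b y) :
    Tendsto (fun r => ∫ y in cBalls x r, f r y) (𝓝[>] 0) (𝓝 0) := by
  simp only [← integral_indicator (measurableSet_cBalls x _)]
  have h0 : (0 : ℂ) = ∫ _ : ℂ, (0 : ℂ) := by simp
  rw [h0]
  apply tendsto_integral_filter_of_dominated_convergence (fun y => ‖b y‖)
  · filter_upwards [hm] with r hr using hr.indicator (measurableSet_cBalls x r)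
  · filter_upwards [hle] with r hr
    filter_upwards [hr] with y hy
    by_cases h : y ∈ cBalls x r
    · rw [Set.indicator_of_mem h]
      exact (hy h).trans (le_abs_self _)
    · rw [Set.indicator_of_notMem h]
      simp
  · exact hb.norm
  · filter_upwards [ae_sub_mem_integerComplement x] with y hy
    obtain ⟨ε, hε, hball⟩ := Metric.isOpen_iff.1 Complex.isOpen_compl_range_intCast _ hy
    apply tendsto_const_nhds.congr'
    filter_upwards [Ioo_mem_nhdsGT hε] with r hr
    rw [Set.indicator_of_notMem]
    intro h
    obtain ⟨n, hn⟩ := Set.mem_iUnion.1 h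
    refine hball (a := -(n : ℂ)) ?_ ⟨-n, by push_cast; rfl⟩
    rw [mem_ball_iff_norm] at hn ⊢
    have e : -(n : ℂ) - (x - y) = y - (x + n) := by ring
    rw [e]
    exact hn.trans hr.2

theorem norm_intCast_sub_ge {m n : ℤ} (h : m ≠ n) : (1 : ℝ) ≤ ‖(m : ℂ) - n‖ := by
  have : (m : ℂ) - n = ((m - n : ℤ) : ℂ) := by push_cast; ring
  rw [this, Complex.norm_intCast]
  exact_mod_cast Int.one_le_abs (sub_ne_zero.2 h)

theorem truncKernel_of_notMem_cBalls {x y : ℂ} {r : ℝ} (hy : y ∉ cBalls x r) (n : ℤ) :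
    truncKernel r (x - n - y) = -((Real.pi : ℂ) * (x - y - n) ^ 2)⁻¹ := by
  have : r ≤ ‖x - n - y‖ := by
    by_contra hlt
    rw [not_le, norm_sub_rev] at hlt
    refine hy (Set.mem_iUnion.2 ⟨-n, ?_⟩)
    have e : y - (x + (-n : ℤ)) = y - (x - n) := by push_cast; ring
    rw [mem_ball_iff_norm, e]
    exact hlt
  rw [truncKernel, if_pos this, sub_right_comm]

theorem integrable_truncKernel_mul {w : ℂ → ℂ} (hw : Integrable w) {r : ℝ} (hr : 0 < r) (x : ℂ) :
    Integrable (fun y => truncKernel r (x - y) * w y) :=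
  hw.bdd_mul ((measurable_truncKernel r).comp
    (measurable_const.sub measurable_id)).aestronglyMeasurable
    (Eventually.of_forall fun _ => norm_truncKernel_le hr _)

/-- The difference between truncating at one lattice point and at all of them is negligible. -/
theorem tendsto_truncKernel_cBalls_compl {w : ℂ → ℂ} (hw : MemLp w ∞) (hwc : HasCompactSupport w)
    {x d : ℂ} (n : ℤ)
    (h : Tendsto (fun r => ∫ y, truncKernel r (x - n - y) * w y) (𝓝[>] 0) (𝓝 d)) :
    Tendsto (fun r => ∫ y in (cBalls x r)ᶜ, -((Real.pi : ℂ) * (x - y - n) ^ 2)⁻¹ * w y)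
      (𝓝[>] 0) (𝓝 d) := by
  have hwi : Integrable w := memLp_one_iff_integrable.1 (memLp_of_memLp_top hw hwc 1)
  have hmeas : ∀ r, AEStronglyMeasurable (fun y => truncKernel r (x - n - y) * w y) volume :=
    fun r => ((measurable_truncKernel r).comp
      (measurable_const.sub measurable_id)).aestronglyMeasurable.mul hw.1
  have h2 := tendsto_setIntegral_cBalls (f := fun r y => truncKernel r (x - n - y) * w y) x
    (hwi.norm.const_mul ((Real.pi * (1 / 2) ^ 2)⁻¹)) (Eventually.of_forall hmeas) (by
      filter_upwards [Ioo_mem_nhdsGT (show (0 : ℝ) < 1 / 2 by norm_num)] with r hr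
      refine Eventually.of_forall fun y hy => ?_
      obtain ⟨m, hm⟩ := Set.mem_iUnion.1 hy
      rw [mem_ball_iff_norm] at hm
      rw [norm_mul]
      gcongr
      -- In its own disc the truncated kernel vanishes. In any other disc the distance to the pole
      -- is at least `1 - r > 1/2`, so the bound at radius `1/2` holds.
      by_cases hmn : m = -n
      · have : ¬ r ≤ ‖x - n - y‖ := by
          have e : y - (x - n) = y - (x + m) := by rw [hmn]; push_cast; ring
          rw [not_le, norm_sub_rev, e]
          exact hm
        rw [truncKernel, if_neg this]
        simp; positivity
      · have h1 := norm_intCast_sub_ge hmn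
        have h3 : ‖(m : ℂ) - (-n : ℤ)‖ ≤ ‖x - n - y‖ + ‖y - (x + m)‖ := by
          rw [← norm_neg ((m : ℂ) - (-n : ℤ))]
          convert norm_add_le (x - n - y) (y - (x + m)) using 2
          push_cast; ring
        have h4 : (1 : ℝ) / 2 ≤ ‖x - n - y‖ := by linarith [hr.2]
        have e : truncKernel r (x - n - y) = truncKernel (1 / 2) (x - n - y) := by
          rw [truncKernel, truncKernel, if_pos h4, if_pos (hr.2.le.trans h4)]
        rw [e]
        exact norm_truncKernel_le (by norm_num) _)
  have h3 := h.sub h2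
  rw [sub_zero] at h3
  refine h3.congr' ?_
  filter_upwards [self_mem_nhdsWithin] with r hr
  have hr0 : (0 : ℝ) < r := hr
  rw [← integral_add_compl (measurableSet_cBalls x r) (integrable_truncKernel_mul hwi hr0 (x - n)),
    add_sub_cancel_left]
  refine setIntegral_congr_fun (measurableSet_cBalls x r).compl fun y hy => ?_
  simp only [truncKernel_of_notMem_cBalls hy n]

/-- Convolution of `w` with the periodic Cauchy kernel. -/
def perTransform (w : ℂ → ℂ) (x : ℂ) : ℂ := ∫ y, perKernel (x - y) * w y

theorem integral_cauchyTransform_sub_fderiv {w D φ : ℂ → ℂ} (hw : Integrable w)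
    (hwc : HasCompactSupport w) (hD : LocallyIntegrable D)
    (hwD : ∀ r, 0 < r → ∀ x,
      ∫ y, truncKernel r (x - y) * w y = ∫ y, discKernel r (x - y) * D y)
    (hφ : ContDiff ℝ ∞ φ) (hc : HasCompactSupport φ) (a : ℂ) :
    ∫ x, cauchyTransform w (x - a) * fderiv ℝ φ x 1 = -∫ x, (D (x - a) + w (x - a)) * φ x ∧
      ∫ x, cauchyTransform w (x - a) * fderiv ℝ φ x Complex.I
        = -∫ x, Complex.I * (D (x - a) - w (x - a)) * φ x := by
  have h := integral_cauchyTransform_fderiv hw hwc hD hwD (locallyIntegrable_cauchyTransform hw hwc)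
    (φ := fun x => φ (x + a)) (hφ.comp (contDiff_id.add contDiff_const))
    (hc.comp_homeomorph (Homeomorph.addRight a))
  simp only [fderiv_comp_add_right] at h
  have e : ∀ f : ℂ → ℂ, ∫ x, f (x - a) = ∫ x, f x := fun f => integral_sub_right_eq_self f a
  constructor
  · rw [← e] at h
    have h1 := h.1
    rw [← e (fun x => (D x + w x) * φ (x + a))] at h1
    simpa using h1
  · have h2 := h.2
    rw [← e, ← e (fun x => Complex.I * (D x - w x) * φ (x + a))] at h2
    simpa using h2

theorem LocallyIntegrable.comp_sub_right_complex {f : ℂ → ℂ} (hf : LocallyIntegrable f) (a : ℂ) :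
    LocallyIntegrable (fun x => f (x - a)) := by
  refine locallyIntegrable_of_forall_ball fun A hA => ?_
  rw [← integrable_indicator_iff Metric.isOpen_ball.measurableSet]
  have h1 : IntegrableOn f (Metric.closedBall (-a) A) :=
    hf.integrableOn_isCompact (isCompact_closedBall _ _)
  have h2 := (h1.mono_set Metric.ball_subset_closedBall).integrable_indicator
    Metric.isOpen_ball.measurableSet
  refine (h2.comp_sub_right a).congr (Eventually.of_forall fun x => ?_)
  by_cases hx : x ∈ Metric.ball (0 : ℂ) A
  · have h3 : x - a ∈ Metric.ball (-a) A := by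
      rw [mem_ball_iff_norm] at hx ⊢
      simpa using hx
    simp only [Set.indicator_of_mem hx, Set.indicator_of_mem h3]
  · have h3 : x - a ∉ Metric.ball (-a) A := by
      rw [mem_ball_iff_norm] at hx ⊢
      simpa using hx
    simp only [Set.indicator_of_notMem hx, Set.indicator_of_notMem h3]

/-! ### The weak gradient on a disc. -/

/-- On a given disc, the transform with the periodic kernel has a weak gradient, whose regular
part is given by principal values. -/
theorem exists_local_gradient {w : ℂ → ℂ} (hw : MemLp w ∞) (hwc : HasCompactSupport w)
    {A : ℝ} (hA : 0 < A) :
    ∃ (F P W : ℂ → ℂ), LocallyIntegrable F ∧ LocallyIntegrable P ∧ LocallyIntegrable W ∧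
      (∀ x, ‖x‖ < A → Integrable (fun y => perKernel (x - y) * w y)) ∧
      (∀ x, ‖x‖ < A → perTransform w x = F x) ∧
      (∀ x, ‖x‖ < A → W x = (∑' n : ℤ, w (x + n)) / 2) ∧
      (∀ x, ‖x‖ < A → ∀ r, 0 < r →
        IntegrableOn (fun y => deriv perKernel (x - y) * w y) (cBalls x r)ᶜ) ∧
      (∀ᵐ x, ‖x‖ < A → Tendsto
        (fun r => ∫ y in (cBalls x r)ᶜ, deriv perKernel (x - y) * w y) (𝓝[>] 0) (𝓝 (P x))) ∧
      ∀ φ : ℂ → ℂ, ContDiff ℝ ∞ φ → HasCompactSupport φ → (∀ x, A ≤ ‖x‖ → φ x = 0) →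
        ∫ x, F x * fderiv ℝ φ x 1 = -∫ x, (P x + W x) * φ x ∧
        ∫ x, F x * fderiv ℝ φ x Complex.I = -∫ x, Complex.I * (P x - W x) * φ x := by
  obtain ⟨R, hR0, hR⟩ := HasCompactSupport.exists_forall_norm_lt hwc
  obtain ⟨N, hN⟩ := exists_nat_ge (4 * (A + R + 1))
  -- This radius contains every `x - y` with `‖x‖ < A` and `y` in the support of `w`.
  obtain ⟨H, hH, hHc, hHd, hHeq⟩ := exists_perKernel_decomposition (R := A + R + 1)
    (by positivity) hN
  have hwi : Integrable w := memLp_one_iff_integrable.1 (memLp_of_memLp_top hw hwc 1)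
  have hwl := hwi.locallyIntegrable
  obtain ⟨D, hD2, hD⟩ := exists_truncKernel_eq_discKernel (memLp_of_memLp_top hw hwc 2)
  have hDl : LocallyIntegrable D := hD2.locallyIntegrable (by norm_num)
  set S := Finset.Icc (-(N : ℤ)) N with hS
  have hnorm : ∀ x y : ℂ, ‖x‖ < A → ¬ R < ‖y‖ → ‖x - y‖ < A + R + 1 := fun x y hx hy =>
    (norm_sub_le x y).trans_lt (by linarith)
  set V : ℂ → ℂ := fun x => ∫ y, w y * H (x - y) with hV
  have hVc : ContDiff ℝ ∞ V :=
    hHc.contDiff_convolution_right (ContinuousLinearMap.mul ℝ ℂ) hwl hH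
  have hVd : ∀ x v, fderiv ℝ V x v = ∫ y, w y * fderiv ℝ H (x - y) v := by
    intro x v
    have hd := hHc.hasFDerivAt_convolution_right (ContinuousLinearMap.mul ℝ ℂ) hwl
      (hH.of_le (by simp)) x
    have h1 : fderiv ℝ V x = _ := hd.fderiv
    rw [h1, convolution_precompR_apply _ hwl (hHc.fderiv ℝ) (hH.continuous_fderiv (by simp))]
    rfl
  -- `H` is holomorphic only near the origin, so `V` satisfies Cauchy-Riemann only on the disc of
  -- radius `A`; hence the restriction on the supports of the test functions.
  have hVI : ∀ x, ‖x‖ < A → fderiv ℝ V x Complex.I = Complex.I * fderiv ℝ V x 1 := by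
    intro x hx
    rw [hVd, hVd, ← integral_const_mul]
    congr 1
    funext y
    by_cases hy : R < ‖y‖
    · simp [hR y hy]
    · rw [fderiv_I_of_differentiableAt (hHd _ (hnorm x y hx hy))]
      ring
  have hker : ∀ x, ‖x‖ < A → ∀ᵐ y, perKernel (x - y) * w y
      = (1 / 2 : ℂ) * ∑ n ∈ S, cauchyKernel (x - n - y) * w y + w y * H (x - y) := by
    intro x hx
    filter_upwards [ae_sub_mem_integerComplement x] with y hy
    by_cases hyR : R < ‖y‖
    · simp [hR y hyR]
    · rw [hHeq _ (hnorm x y hx hyR) hy, ← Finset.sum_mul]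
      simp only [sub_right_comm x _ y]
      ring
  have hci : ∀ x n, Integrable (fun y => cauchyKernel (x - n - y) * w y) := fun x n =>
    integrable_kernel_mul locallyIntegrable_cauchyKernel hw hwc (x - n)
  have hcs : ∀ x, Integrable (fun y => (1 / 2 : ℂ) * ∑ n ∈ S, cauchyKernel (x - (n : ℂ) - y) * w y) :=
    fun x => (integrable_finsetSum S fun n _ => hci x n).const_mul _
  have hHi : ∀ x, Integrable (fun y => w y * H (x - y)) := fun x => by
    simpa only [mul_comm] using
      integrable_kernel_mul (hH.continuous.locallyIntegrable (μ := volume)) hw hwc x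
  have hCl := fun n : ℤ => LocallyIntegrable.comp_sub_right_complex
    (locallyIntegrable_cauchyTransform hwi hwc) n
  have hDln := fun n : ℤ => LocallyIntegrable.comp_sub_right_complex hDl n
  have hwln := fun n : ℤ => LocallyIntegrable.comp_sub_right_complex hwl n
  have hsum : ∀ f : ℤ → ℂ → ℂ, (∀ n, LocallyIntegrable (f n)) →
      LocallyIntegrable (fun x => (1 / 2 : ℂ) * ∑ n ∈ S, f n x) := fun f hf =>
    (locallyIntegrable_finsetSum S fun n _ => hf n).smul (1 / 2 : ℂ)
  have hdHi : ∀ x, Integrable (fun y => w y * fderiv ℝ H (x - y) 1) := fun x => by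
    simpa only [mul_comm] using integrable_kernel_mul
      ((contDiff_fderiv_apply_infty hH 1).continuous.locallyIntegrable (μ := volume)) hw hwc x
  have hqi : ∀ x r, 0 < r → ∀ n : ℤ,
      IntegrableOn (fun y => -((Real.pi : ℂ) * (x - y - n) ^ 2)⁻¹ * w y) (cBalls x r)ᶜ := by
    intro x r hr n
    refine (integrable_truncKernel_mul hwi hr (x - n)).integrableOn.congr_fun (fun y hy => ?_)
      (measurableSet_cBalls x r).compl
    simp only [truncKernel_of_notMem_cBalls hy n]
  have hdker : ∀ x, ‖x‖ < A → ∀ᵐ y, deriv perKernel (x - y) * w y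
      = (1 / 2 : ℂ) * ∑ n ∈ S, -((Real.pi : ℂ) * (x - y - n) ^ 2)⁻¹ * w y
        + w y * fderiv ℝ H (x - y) 1 := by
    intro x hxA
    filter_upwards [ae_sub_mem_integerComplement x] with y hy
    by_cases hyR : R < ‖y‖
    · simp [hR y hyR]
    · rw [deriv_perKernel_eq hHd hHeq (hnorm x y hxA hyR) hy, ← Finset.sum_mul]
      ring
  -- On the disc, `P` is `∂F/∂z` and `W` is `∂F/∂z̄`; the smooth part `V` contributes to `P` alone.
  refine ⟨fun x => (1 / 2 : ℂ) * ∑ n ∈ S, cauchyTransform w (x - n) + V x,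
    fun x => (1 / 2 : ℂ) * ∑ n ∈ S, D (x - n) + fderiv ℝ V x 1,
    fun x => (1 / 2 : ℂ) * ∑ n ∈ S, w (x - n),
    (hsum _ hCl).add hVc.continuous.locallyIntegrable,
    (hsum _ hDln).add (contDiff_fderiv_apply_infty hVc 1).continuous.locallyIntegrable,
    hsum _ hwln, ?_, ?_, ?_, ?_, ?_, ?_⟩
  · intro x hx
    exact ((hcs x).add (hHi x)).congr (by filter_upwards [hker x hx] with y hy using hy.symm)
  · intro x hx
    rw [perTransform, integral_congr_ae (hker x hx), integral_add (hcs x) (hHi x),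
      integral_const_mul, integral_finsetSum S fun n _ => hci x n]
    rfl
  · intro x hx
    have e : ∑' n : ℤ, w (x + n) = ∑' n : ℤ, w (x - n) := by
      rw [← (Equiv.neg ℤ).tsum_eq]
      simp [sub_eq_add_neg]
    -- `N` exceeds `A + R`, so the omitted translates of the support of `w` miss the disc.
    have h0 : ∀ n ∉ S, w (x - (n : ℂ)) = 0 := by
      intro n hn
      apply hR
      have h1 : (N : ℝ) < ‖(n : ℂ)‖ := by
        rw [Complex.norm_intCast]
        by_contra hle
        rw [not_lt] at hle
        have h2 : |n| ≤ (N : ℤ) := by exact_mod_cast hle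
        exact hn (Finset.mem_Icc.2 (abs_le.1 h2))
      have h2 := norm_sub_norm_le (n : ℂ) x
      rw [norm_sub_rev] at h2
      linarith
    rw [e, tsum_eq_sum h0]
    ring
  · intro x hx r hr
    refine Integrable.congr (((integrable_finsetSum S fun n _ => hqi x r hr n).const_mul
      (1 / 2 : ℂ)).add (hdHi x).integrableOn) (ae_restrict_of_ae ?_)
    filter_upwards [hdker x hx] with y hy using hy.symm
  · have hae : ∀ᵐ x, ∀ n : ℤ, Tendsto (fun r => ∫ y, truncKernel r (x - n - y) * w y)
        (𝓝[>] 0) (𝓝 (D (x - n))) := by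
      rw [ae_all_iff]
      intro n
      have h1 : ∀ᵐ x, Tendsto (fun r => ∫ y, truncKernel r (x - y) * w y) (𝓝[>] 0)
          (𝓝 (D x)) := by
        filter_upwards [ae_tendsto_discKernel hDl] with x hx
        refine hx.congr' ?_
        filter_upwards [self_mem_nhdsWithin] with r hr using (hD r hr x).symm
      exact (measurePreserving_sub_right volume (n : ℂ)).quasiMeasurePreserving.ae h1
    filter_upwards [hae] with x hx hxA
    have t1 := fun n : ℤ => tendsto_truncKernel_cBalls_compl hw hwc n (hx n)
    have t2 : Tendsto (fun r => ∫ y in (cBalls x r)ᶜ, w y * fderiv ℝ H (x - y) 1) (𝓝[>] 0)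
        (𝓝 (fderiv ℝ V x 1)) := by
      have h1 := tendsto_setIntegral_cBalls (f := fun _ y => w y * fderiv ℝ H (x - y) 1) x
        (hdHi x).norm (Eventually.of_forall fun _ => (hdHi x).1)
        (Eventually.of_forall fun _ => Eventually.of_forall fun y _ => le_rfl)
      have h2 := h1.const_sub (∫ y, w y * fderiv ℝ H (x - y) 1)
      rw [sub_zero, ← hVd] at h2
      refine h2.congr fun r => ?_
      rw [hVd, ← integral_add_compl (measurableSet_cBalls x r) (hdHi x), add_sub_cancel_left]
    have t3 := ((tendsto_finsetSum S fun n _ => t1 n).const_mul (1 / 2 : ℂ)).add t2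
    refine t3.congr' ?_
    filter_upwards [self_mem_nhdsWithin] with r hr
    have hr0 : (0 : ℝ) < r := hr
    rw [← integral_finsetSum S fun n _ => hqi x r hr0 n, ← integral_const_mul,
      ← integral_add ((integrable_finsetSum S fun n _ => hqi x r hr0 n).const_mul _)
        (hdHi x).integrableOn]
    refine integral_congr_ae (ae_restrict_of_ae ?_)
    filter_upwards [hdker x hxA] with y hy using hy.symm
  · intro φ hφ hc hφA
    have hint : ∀ {f g : ℂ → ℂ}, LocallyIntegrable f → ContDiff ℝ ∞ g → HasCompactSupport g →
        Integrable (fun x => f x * g x) := fun hf hg hgc =>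
      by simpa [mul_comm] using hf.integrable_smul_left_of_hasCompactSupport hg.continuous hgc
    have hdc : ∀ v, HasCompactSupport (fun x => fderiv ℝ φ x v) := fun v => hc.fderiv_apply ℝ v
    have hds := fun v => contDiff_fderiv_apply_infty hφ v
    have split : ∀ v, ∫ x, ((1 / 2 : ℂ) * ∑ n ∈ S, cauchyTransform w (x - n) + V x)
          * fderiv ℝ φ x v
        = (1 / 2 : ℂ) * ∑ n ∈ S, (∫ x, cauchyTransform w (x - (n : ℂ)) * fderiv ℝ φ x v)
          - ∫ x, fderiv ℝ V x v * φ x := by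
      intro v
      have hi := fun n : ℤ => hint (hCl n) (hds v) (hdc v)
      have e : ∀ x, ((1 / 2 : ℂ) * ∑ n ∈ S, cauchyTransform w (x - n) + V x) * fderiv ℝ φ x v
          = (1 / 2 : ℂ) * ∑ n ∈ S, cauchyTransform w (x - (n : ℂ)) * fderiv ℝ φ x v
            + V x * fderiv ℝ φ x v := by
        intro x
        rw [add_mul, mul_assoc, Finset.sum_mul]
      obtain ⟨i1, -, i3⟩ := integral_mul_fderiv_test hVc hφ hc v
      rw [funext e, integral_add ((integrable_finsetSum S fun n _ => hi n).const_mul _) i1,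
        integral_const_mul, integral_finsetSum S fun n _ => hi n, i3]
      ring
    have hsh := fun n : ℤ => integral_cauchyTransform_sub_fderiv hwi hwc hDl hD hφ hc n
    constructor
    · rw [split 1]
      simp only [(hsh _).1]
      have hi : ∀ n : ℤ, Integrable (fun x => (D (x - n) + w (x - n)) * φ x) :=
        fun n => hint ((hDln n).add (hwln n)) hφ hc
      have e : ∀ x, ((1 / 2 : ℂ) * ∑ n ∈ S, D (x - n) + fderiv ℝ V x 1
            + (1 / 2 : ℂ) * ∑ n ∈ S, w (x - n)) * φ x
          = (1 / 2 : ℂ) * ∑ n ∈ S, (D (x - (n : ℂ)) + w (x - n)) * φ x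
            + fderiv ℝ V x 1 * φ x := by
        intro x
        rw [← Finset.sum_mul, Finset.sum_add_distrib]
        ring
      rw [funext e, integral_add ((integrable_finsetSum S fun n _ => hi n).const_mul _)
        (integral_mul_fderiv_test hVc hφ hc 1).2.1, integral_const_mul,
        integral_finsetSum S fun n _ => hi n, Finset.sum_neg_distrib]
      ring
    · rw [split Complex.I]
      simp only [(hsh _).2]
      have hi : ∀ n : ℤ, Integrable (fun x => Complex.I * (D (x - n) - w (x - n)) * φ x) :=
        fun n => by
          simpa only [mul_assoc, Pi.sub_apply] using
            (hint ((hDln n).sub (hwln n)) hφ hc).const_mul Complex.I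
      have e : ∀ x, Complex.I * ((1 / 2 : ℂ) * ∑ n ∈ S, D (x - n) + fderiv ℝ V x 1
            - (1 / 2 : ℂ) * ∑ n ∈ S, w (x - n)) * φ x
          = (1 / 2 : ℂ) * ∑ n ∈ S, Complex.I * (D (x - (n : ℂ)) - w (x - n)) * φ x
            + fderiv ℝ V x Complex.I * φ x := by
        intro x
        rw [← Finset.sum_mul, ← Finset.mul_sum, Finset.sum_sub_distrib]
        by_cases hx : A ≤ ‖x‖
        · simp [hφA x hx]
        · rw [hVI x (not_le.1 hx)]
          ring
      rw [funext e, integral_add ((integrable_finsetSum S fun n _ => hi n).const_mul _)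
        (integral_mul_fderiv_test hVc hφ hc Complex.I).2.1, integral_const_mul,
        integral_finsetSum S fun n _ => hi n, Finset.sum_neg_distrib]
      ring

/-! ### The plane as `ℂ`, and the gradient of the kernel. -/

/-- The identification of the plane with `ℂ`. -/
def planeEquiv : Plane ≃ₗᵢ[ℝ] ℂ := Complex.orthonormalBasisOneI.repr.symm

theorem planeEquiv_symm_apply (z : ℂ) : planeEquiv.symm z = ofC z := by
  ext i
  fin_cases i <;> simp [planeEquiv, ofC]

theorem planeEquiv_apply (x : Plane) : planeEquiv x = toC x := by
  rw [← planeEquiv.symm.injective.eq_iff, LinearIsometryEquiv.symm_apply_apply,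
    planeEquiv_symm_apply]
  ext i
  fin_cases i <;> simp [ofC, toC]

theorem planeEquiv_shift (n : ℤ) : planeEquiv (shift n) = n := by
  rw [planeEquiv_apply]
  apply Complex.ext <;> simp [toC, shift]

theorem planeEquiv_single_zero : planeEquiv (EuclideanSpace.single 0 1) = 1 := by
  rw [planeEquiv_apply]
  apply Complex.ext <;> simp [toC]

theorem planeEquiv_single_one : planeEquiv (EuclideanSpace.single 1 1) = Complex.I := by
  rw [planeEquiv_apply]
  apply Complex.ext <;> simp [toC]

theorem planeEquiv_mem_integerComplement {x : Plane} (hx : x ∉ lattice) :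
    planeEquiv x ∈ Complex.integerComplement := by
  rintro ⟨n, hn⟩
  refine hx ⟨n, ?_⟩
  rw [← planeEquiv_shift] at hn
  exact planeEquiv.injective hn

/-- The linear map `z ↦ (Im z, Re z)`. -/
def swapCLM : ℂ →L[ℝ] Plane :=
  (planeEquiv.symm : ℂ ≃ₗᵢ[ℝ] Plane).toContinuousLinearEquiv.toContinuousLinearMap.comp
    (Complex.I • (Complex.conjCLE : ℂ →L[ℝ] ℂ))

theorem swapCLM_zero (z : ℂ) : swapCLM z 0 = z.im := by
  simp [swapCLM, planeEquiv_symm_apply, ofC]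

theorem swapCLM_one (z : ℂ) : swapCLM z 1 = z.re := by
  simp [swapCLM, planeEquiv_symm_apply, ofC]

/-- The cotangent commutes with conjugation, and the rotation of `conj c` is `(Im c, Re c)`. -/
theorem Kinf_eq (x : Plane) : Kinf x = swapCLM (perKernel (planeEquiv x)) := by
  have h : Complex.cot ((Real.pi : ℂ) * conj (toC x))
      = conj (Complex.cot ((Real.pi : ℂ) * toC x)) := by
    rw [← Complex.cot_conj, map_mul, Complex.conj_ofReal]
  rw [Kinf, h, planeEquiv_apply, perKernel]
  ext i
  fin_cases i
  · simp [perp, ofC, swapCLM_zero]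
    ring
  · simp [perp, ofC, swapCLM_one]
    ring

theorem hasFDerivAt_Kinf {x : Plane} (hx : x ∉ lattice) :
    HasFDerivAt Kinf (swapCLM.comp
      ((deriv perKernel (planeEquiv x) • (1 : ℂ →L[ℝ] ℂ)).comp
        planeEquiv.toContinuousLinearEquiv.toContinuousLinearMap)) x := by
  have hz := planeEquiv_mem_integerComplement hx
  have h1 : HasFDerivAt perKernel (deriv perKernel (planeEquiv x) • (1 : ℂ →L[ℝ] ℂ))
      (planeEquiv x) :=
    (hasDerivAt_perKernel hz).differentiableAt.hasDerivAt.complexToReal_fderiv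
  have h2 := swapCLM.hasFDerivAt.comp x (h1.comp x
    planeEquiv.toContinuousLinearEquiv.toContinuousLinearMap.hasFDerivAt)
  exact h2.congr_of_eventuallyEq (Eventually.of_forall fun y => Kinf_eq y)

/-- The entries of the real matrix `(Im z, Re z; Re z, -Im z)`. -/
def entryCLM (i j : Fin 2) : ℂ →L[ℝ] ℝ :=
  !![Complex.imCLM, Complex.reCLM; Complex.reCLM, -Complex.imCLM] i j

/-- The columns are the images under `swapCLM` of `f'` and `i f'`, namely `(Im f', Re f')` and `(Re
f', -Im f')`. -/
theorem grad_Kinf_apply {x : Plane} (hx : x ∉ lattice) (i j : Fin 2) :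
    grad Kinf x i j = entryCLM i j (deriv perKernel (planeEquiv x)) := by
  rw [grad, Matrix.of_apply, (hasFDerivAt_Kinf hx).fderiv]
  fin_cases i <;> fin_cases j <;>
    simp [entryCLM, swapCLM_zero, swapCLM_one, planeEquiv_single_zero, planeEquiv_single_one]

theorem sin_pi_mul_planeEquiv (x : Plane) : Complex.sin ((Real.pi : ℂ) * planeEquiv x)
    = ⟨Real.sin (Real.pi * x 0) * Real.cosh (Real.pi * x 1),
        Real.cos (Real.pi * x 0) * Real.sinh (Real.pi * x 1)⟩ := by
  have e : (Real.pi : ℂ) * planeEquiv x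
      = ((Real.pi * x 0 : ℝ) : ℂ) + ((Real.pi * x 1 : ℝ) : ℂ) * Complex.I := by
    rw [planeEquiv_apply]
    apply Complex.ext <;> simp [toC]
  rw [e, Complex.sin_add_mul_I, ← Complex.ofReal_sin, ← Complex.ofReal_cos, ← Complex.ofReal_sinh,
    ← Complex.ofReal_cosh, ← Complex.ofReal_mul, ← Complex.ofReal_mul]
  exact (Complex.mk_eq_add_mul_I _ _).symm

theorem rho_sq_eq (x : Plane) :
    rho x ^ 2 = Real.sin (Real.pi * x 0) ^ 2 + Real.sinh (Real.pi * x 1) ^ 2 :=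
  Real.sq_sqrt (by positivity)

/-- `ρ = |sin(πz)|`, because `sin² cosh² + cos² sinh² = sin² + sinh²`. Positivity of `ρ` off the
lattice follows. -/
theorem normSq_sin_pi_mul_planeEquiv (x : Plane) :
    Complex.normSq (Complex.sin ((Real.pi : ℂ) * planeEquiv x)) = rho x ^ 2 := by
  rw [rho_sq_eq, sin_pi_mul_planeEquiv, Complex.normSq_mk]
  have h1 := Real.sin_sq_add_cos_sq (Real.pi * x 0)
  have h2 := Real.cosh_sq (Real.pi * x 1)
  linear_combination Real.sin (Real.pi * x 0) ^ 2 * h2 + Real.sinh (Real.pi * x 1) ^ 2 * h1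

theorem rho_pos {x : Plane} (hx : x ∉ lattice) : 0 < rho x := by
  have h := Complex.normSq_pos.2 (sin_pi_mul_ne_zero (planeEquiv_mem_integerComplement hx))
  rw [normSq_sin_pi_mul_planeEquiv] at h
  exact (Real.sqrt_nonneg _).lt_of_ne' fun h0 => by simp [rho, h0] at h

/-- The derivative is `-(π/2)/s²` with `s = sin(πz)`, and `1/s² = conj(s²)/ρ⁴`; double-angle
formulas give the real and imaginary parts of `s²`. -/
theorem deriv_perKernel_planeEquiv {x : Plane} (hx : x ∉ lattice) :
    (deriv perKernel (planeEquiv x)).re = Real.pi / 2 * ((1 / rho x ^ 2) * ((1 / (2 * rho x ^ 2)) *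
      (Real.cos (2 * Real.pi * x 0) * Real.cosh (2 * Real.pi * x 1) - 1))) ∧
    (deriv perKernel (planeEquiv x)).im = Real.pi / 2 * ((1 / rho x ^ 2) * ((1 / (2 * rho x ^ 2)) *
      (Real.sin (2 * Real.pi * x 0) * Real.sinh (2 * Real.pi * x 1)))) := by
  have hr := (rho_pos hx).ne'
  have hd : deriv perKernel (planeEquiv x) = ((-(Real.pi / 2) : ℝ) : ℂ) *
      (Complex.sin ((Real.pi : ℂ) * planeEquiv x) ^ 2)⁻¹ := by
    rw [(hasDerivAt_perKernel (planeEquiv_mem_integerComplement hx)).deriv]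
    push_cast
    ring
  have h1 := Real.sin_sq_add_cos_sq (Real.pi * x 0)
  have h2 := Real.cosh_sq (Real.pi * x 1)
  rw [hd, Complex.re_ofReal_mul, Complex.im_ofReal_mul, Complex.inv_re, Complex.inv_im,
    map_pow Complex.normSq, normSq_sin_pi_mul_planeEquiv, mul_assoc 2, mul_assoc 2,
    Real.cos_two_mul, Real.cosh_two_mul, Real.sin_two_mul, Real.sinh_two_mul]
  simp only [sin_pi_mul_planeEquiv, pow_two (Complex.mk _ _), Complex.mul_re, Complex.mul_im]
  generalize Real.sin (Real.pi * x 0) = s at *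
  generalize Real.cos (Real.pi * x 0) = c at *
  generalize Real.cosh (Real.pi * x 1) = C at *
  generalize Real.sinh (Real.pi * x 1) = S at *
  constructor
  · field_simp
    have h3 : c ^ 2 = 1 - s ^ 2 := by linear_combination h1
    simp only [h2, h3]
    ring
  · field_simp
    ring

theorem grad_Kinf {x : Plane} (hx : x ∉ lattice) :
    grad Kinf x = (Real.pi / 2) • ((1 / rho x ^ 2) • beta x) := by
  obtain ⟨h1, h2⟩ := deriv_perKernel_planeEquiv hx
  ext i j
  rw [grad_Kinf_apply hx]
  fin_cases i <;> fin_cases j <;> simp [entryCLM, beta, h1, h2]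

/-! ### Transfer of integrals and principal values to the plane. -/

theorem measurePreserving_planeEquiv : MeasurePreserving planeEquiv :=
  planeEquiv.measurePreserving

theorem measurableEmbedding_planeEquiv : MeasurableEmbedding planeEquiv :=
  planeEquiv.toHomeomorph.measurableEmbedding

/-- A real function on the plane as a complex function on `ℂ`. -/
def complexify (f : Plane → ℝ) (z : ℂ) : ℂ := f (planeEquiv.symm z)

theorem complexify_planeEquiv (f : Plane → ℝ) (x : Plane) :
    complexify f (planeEquiv x) = f x := by
  simp [complexify]

theorem memLp_complexify {f : Plane → ℝ} {p : ℝ≥0∞} (hf : MemLp f p) : MemLp (complexify f) p :=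
  (hf.comp_measurePreserving planeEquiv.symm.measurePreserving).ofReal

theorem hasCompactSupport_complexify {f : Plane → ℝ} (hf : HasCompactSupport f) :
    HasCompactSupport (complexify f) :=
  (hf.comp_homeomorph planeEquiv.symm.toHomeomorph).comp_left Complex.ofReal_zero

theorem contDiff_complexify {f : Plane → ℝ} (hf : ContDiff ℝ ∞ f) : ContDiff ℝ ∞ (complexify f) :=
  Complex.ofRealCLM.contDiff.comp
    (hf.comp planeEquiv.symm.toContinuousLinearEquiv.contDiff)

theorem fderiv_complexify {f : Plane → ℝ} (hf : ContDiff ℝ ∞ f) (x v : Plane) :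
    fderiv ℝ (complexify f) (planeEquiv x) (planeEquiv v) = (fderiv ℝ f x v : ℂ) := by
  have h1 : HasFDerivAt f (fderiv ℝ f x) (planeEquiv.symm (planeEquiv x)) := by
    rw [planeEquiv.symm_apply_apply]
    exact (hf.differentiable (by simp) x).hasFDerivAt
  have h2 : fderiv ℝ (complexify f) (planeEquiv x) = _ :=
    (Complex.ofRealCLM.hasFDerivAt.comp (planeEquiv x) (h1.comp (planeEquiv x)
    planeEquiv.symm.toContinuousLinearEquiv.toContinuousLinearMap.hasFDerivAt)).fderiv
  have h3 := congrArg (fun T => T (planeEquiv v)) h2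
  simpa [planeEquiv.symm_apply_apply] using h3

theorem velocity_integrand (w : Plane → ℝ) (x y : Plane) :
    ContinuousLinearMap.lsmul ℝ ℝ (w y) (Kinf (x - y))
      = swapCLM (perKernel (planeEquiv x - planeEquiv y) * complexify w (planeEquiv y)) := by
  rw [complexify_planeEquiv, mul_comm, ← Complex.real_smul, map_smul, Kinf_eq, map_sub]
  rfl

theorem velocity_eq {w : Plane → ℝ} {x : Plane}
    (h : Integrable (fun z => perKernel (planeEquiv x - z) * complexify w z)) :
    velocity w x = swapCLM (perTransform (complexify w) (planeEquiv x)) := by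
  rw [velocity, convolution_def]
  simp only [velocity_integrand]
  rw [measurePreserving_planeEquiv.integral_comp measurableEmbedding_planeEquiv
    (fun z => swapCLM (perKernel (planeEquiv x - z) * complexify w z)),
    swapCLM.integral_comp_comm h]
  rfl

theorem latticeBalls_eq (x : Plane) (r : ℝ) :
    latticeBalls x r = planeEquiv ⁻¹' cBalls (planeEquiv x) r := by
  ext y
  simp only [latticeBalls, cBalls, Set.mem_iUnion, Set.mem_preimage, Metric.mem_ball]
  refine exists_congr fun n => ?_
  rw [← planeEquiv_shift, ← map_add, planeEquiv.dist_map]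

theorem sub_notMem_lattice {x y : Plane} {r : ℝ} (hr : 0 < r) (hy : y ∈ (latticeBalls x r)ᶜ) :
    x - y ∉ lattice := by
  rintro ⟨n, hn⟩
  refine hy (Set.mem_iUnion.2 ⟨-n, ?_⟩)
  have e : shift (-n) = -shift n := by
    ext i
    fin_cases i <;> simp [shift]
  rw [e, hn]
  simpa using hr

theorem measurableSet_latticeBalls (x : Plane) (r : ℝ) : MeasurableSet (latticeBalls x r) :=
  (isOpen_iUnion fun _ => Metric.isOpen_ball).measurableSet

theorem smul_grad_Kinf_apply {x y : Plane} (hxy : x - y ∉ lattice) (w : Plane → ℝ) (i j : Fin 2) :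
    (w y • grad Kinf (x - y)) i j = entryCLM i j
      (deriv perKernel (planeEquiv x - planeEquiv y) * complexify w (planeEquiv y)) := by
  rw [complexify_planeEquiv, mul_comm, ← Complex.real_smul, map_smul, Matrix.smul_apply,
    grad_Kinf_apply hxy, map_sub]

/-- The principal value, from that of the complex kernel. -/
theorem hasPrincipalValue_of_tendsto {w : Plane → ℝ} {x : Plane} {p : ℂ}
    (hint : ∀ r, 0 < r → IntegrableOn
      (fun z => deriv perKernel (planeEquiv x - z) * complexify w z) (cBalls (planeEquiv x) r)ᶜ)
    (hlim : Tendsto (fun r => ∫ z in (cBalls (planeEquiv x) r)ᶜ,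
      deriv perKernel (planeEquiv x - z) * complexify w z) (𝓝[>] 0) (𝓝 p)) :
    HasPrincipalValue (fun y => w y • grad Kinf (x - y)) x
      (Matrix.of fun i j => entryCLM i j p) := by
  intro i j
  constructor
  · intro r hr
    have h1 : IntegrableOn ((fun z => entryCLM i j (deriv perKernel (planeEquiv x - z)
        * complexify w z)) ∘ planeEquiv) (planeEquiv ⁻¹' (cBalls (planeEquiv x) r)ᶜ) :=
      (measurePreserving_planeEquiv.integrableOn_comp_preimage
        measurableEmbedding_planeEquiv).2 ((entryCLM i j).integrable_comp (hint r hr))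
    rw [Set.preimage_compl, ← latticeBalls_eq] at h1
    refine h1.congr_fun (fun y hy => ?_) (measurableSet_latticeBalls x r).compl
    exact (smul_grad_Kinf_apply (sub_notMem_lattice hr hy) w i j).symm
  · refine ((((entryCLM i j).continuous.tendsto p).comp hlim).congr' ?_)
    filter_upwards [self_mem_nhdsWithin] with r hr
    rw [Function.comp_apply, ← (entryCLM i j).integral_comp_comm (hint r hr),
      ← measurePreserving_planeEquiv.setIntegral_preimage_emb measurableEmbedding_planeEquiv,
      Set.preimage_compl, ← latticeBalls_eq]
    refine setIntegral_congr_fun (measurableSet_latticeBalls x r).compl fun y hy => ?_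
    exact (smul_grad_Kinf_apply (sub_notMem_lattice hr hy) w i j).symm

theorem HasPrincipalValue.unique {f : Plane → Matrix (Fin 2) (Fin 2) ℝ} {x : Plane}
    {P Q : Matrix (Fin 2) (Fin 2) ℝ} (hP : HasPrincipalValue f x P)
    (hQ : HasPrincipalValue f x Q) : P = Q := by
  ext i j
  exact tendsto_nhds_unique (hP i j).2 (hQ i j).2

theorem finite_shift_mem_support {w : Plane → ℝ} (hw : HasCompactSupport w) (x : Plane) :
    {n : ℤ | w (x + shift n) ≠ 0}.Finite := by
  obtain ⟨R, -, hR⟩ := HasCompactSupport.exists_forall_norm_lt (hasCompactSupport_complexify hw)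
  obtain ⟨N, hN⟩ := exists_nat_ge (R + ‖planeEquiv x‖)
  refine (Set.finite_Icc (-(N : ℤ)) N).subset fun n hn => ?_
  by_contra hnot
  refine hn ?_
  have h1 : (N : ℝ) < ‖(n : ℂ)‖ := by
    rw [Complex.norm_intCast]
    by_contra hle
    rw [not_lt] at hle
    have h2 : |n| ≤ (N : ℤ) := by exact_mod_cast hle
    exact hnot (Set.mem_Icc.2 (abs_le.1 h2))
  have h2 := norm_sub_le (planeEquiv x + (n : ℂ)) (planeEquiv x)
  rw [add_sub_cancel_left] at h2
  have h3 := hR (planeEquiv x + n) (by linarith)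
  rw [← planeEquiv_shift, ← map_add, complexify_planeEquiv] at h3
  exact_mod_cast h3

theorem tsum_complexify (w : Plane → ℝ) (x : Plane) :
    (∑' n : ℤ, complexify w (planeEquiv x + n)) / 2 = ((∑' n : ℤ, w (x + shift n) / 2 : ℝ) : ℂ) := by
  simp only [← planeEquiv_shift, ← map_add, complexify_planeEquiv]
  rw [tsum_div_const, Complex.ofReal_div, Complex.ofReal_tsum]
  norm_num

theorem locallyIntegrable_of_ball {E : Type*} [NormedAddCommGroup E] {f : Plane → E}
    (h : ∀ A, 0 < A → IntegrableOn f (planeEquiv ⁻¹' Metric.ball 0 A)) :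
    LocallyIntegrable f := fun x =>
  ⟨planeEquiv ⁻¹' Metric.ball 0 (‖planeEquiv x‖ + 1),
    (Metric.isOpen_ball.preimage planeEquiv.continuous).mem_nhds (by simp), h _ (by positivity)⟩

theorem integrableOn_comp_planeEquiv {E : Type*} [NormedAddCommGroup E] [NormedSpace ℝ E] {f : ℂ → ℂ}
    (hf : LocallyIntegrable f) (L : ℂ →L[ℝ] E) (A : ℝ) :
    IntegrableOn (fun x => L (f (planeEquiv x))) (planeEquiv ⁻¹' Metric.ball 0 A) := by
  have h1 : IntegrableOn f (Metric.ball 0 A) :=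
    (hf.integrableOn_isCompact (isCompact_closedBall _ _)).mono_set Metric.ball_subset_closedBall
  exact (measurePreserving_planeEquiv.integrableOn_comp_preimage
    measurableEmbedding_planeEquiv).2 (L.integrable_comp h1)

/-! ### Gluing the local gradients. -/

open Classical in
/-- The gradient field: the lattice sum plus the principal value, where the latter exists. -/
def gradField (w : Plane → ℝ) (x : Plane) : Matrix (Fin 2) (Fin 2) ℝ :=
  (∑' n : ℤ, w (x + shift n) / 2) • !![0, -1; 1, 0] +
    if h : ∃ P, HasPrincipalValue (fun y => w y • grad Kinf (x - y)) x P then h.choose else 0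

/-- Uniqueness of limits makes the choice harmless. Defining the field by principal values gives one
field on the whole plane, agreeing almost everywhere with the gradient found on each disc. -/
theorem gradField_eq {w : Plane → ℝ} {x : Plane} {P : Matrix (Fin 2) (Fin 2) ℝ}
    (hP : HasPrincipalValue (fun y => w y • grad Kinf (x - y)) x P) :
    gradField w x = (∑' n : ℤ, w (x + shift n) / 2) • !![0, -1; 1, 0] + P := by
  have h : ∃ P, HasPrincipalValue (fun y => w y • grad Kinf (x - y)) x P := ⟨P, hP⟩
  rw [gradField, dif_pos h, h.choose_spec.unique hP]

/-- The coordinates of `swapCLM`. -/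
def coordCLM (i : Fin 2) : ℂ →L[ℝ] ℝ := ![Complex.imCLM, Complex.reCLM] i

theorem swapCLM_apply (z : ℂ) (i : Fin 2) : swapCLM z i = coordCLM i z := by
  fin_cases i
  · exact swapCLM_zero z
  · exact swapCLM_one z

theorem coordCLM_mul_ofReal (i : Fin 2) (z : ℂ) (t : ℝ) : coordCLM i (z * t) = coordCLM i z * t := by
  rw [mul_comm, ← Complex.real_smul, map_smul, smul_eq_mul, mul_comm]

/-- Transport of `exists_local_gradient`. Since the vorticity is real, so is `W` on the disc, which
is why it enters through the rotation matrix only. -/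
theorem exists_local_planar_gradient {w : Plane → ℝ} (hw : MemLp w ∞) (hwc : HasCompactSupport w)
    {A : ℝ} (hA : 0 < A) :
    ∃ F P W : ℂ → ℂ, LocallyIntegrable F ∧ LocallyIntegrable P ∧ LocallyIntegrable W ∧
      (∀ x, ‖planeEquiv x‖ < A → ConvolutionExistsAt w Kinf x (ContinuousLinearMap.lsmul ℝ ℝ) volume) ∧
      (∀ x, ‖planeEquiv x‖ < A → velocity w x = swapCLM (F (planeEquiv x))) ∧
      (∀ᵐ x, ‖planeEquiv x‖ < A →
        (∃ Q, HasPrincipalValue (fun y => w y • grad Kinf (x - y)) x Q) ∧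
        (W (planeEquiv x)).im = 0 ∧
        ∀ i j, gradField w x i j = entryCLM i j (P (planeEquiv x))
          + (W (planeEquiv x)).re * !![0, -1; 1, 0] i j) ∧
      ∀ φ : ℂ → ℂ, ContDiff ℝ ∞ φ → HasCompactSupport φ → (∀ x, A ≤ ‖x‖ → φ x = 0) →
        ∫ x, F x * fderiv ℝ φ x 1 = -∫ x, (P x + W x) * φ x ∧
        ∫ x, F x * fderiv ℝ φ x Complex.I = -∫ x, Complex.I * (P x - W x) * φ x := by
  obtain ⟨F, P, W, hF, hP, hW, h1, h2, h3, h4, h5, h6⟩ :=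
    exists_local_gradient (memLp_complexify hw) (hasCompactSupport_complexify hwc) hA
  refine ⟨F, P, W, hF, hP, hW, fun x hx => ?_, fun x hx => ?_, ?_, h6⟩
  · have := (measurePreserving_planeEquiv.integrable_comp_emb
      measurableEmbedding_planeEquiv).2 (swapCLM.integrable_comp (h1 _ hx))
    refine Integrable.congr this (Eventually.of_forall fun y => ?_)
    exact (velocity_integrand w x y).symm
  · rw [velocity_eq (h1 _ hx), h2 _ hx]
  · filter_upwards [measurePreserving_planeEquiv.quasiMeasurePreserving.ae h5] with x hx hxA
    have hpv := hasPrincipalValue_of_tendsto (h4 _ hxA) (hx hxA)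
    have hWx : W (planeEquiv x) = ((∑' n : ℤ, w (x + shift n) / 2 : ℝ) : ℂ) := by
      rw [h3 _ hxA, tsum_complexify]
    refine ⟨⟨_, hpv⟩, by rw [hWx, Complex.ofReal_im], fun i j => ?_⟩
    rw [gradField_eq hpv, hWx, Complex.ofReal_re, Matrix.add_apply, Matrix.smul_apply,
      smul_eq_mul, add_comm]
    rfl

theorem hasWeakGradient_velocity {w : Plane → ℝ} (hw : MemLp w ∞) (hwc : HasCompactSupport w) :
    HasWeakGradient (velocity w) (gradField w) := by
  have hms : ∀ A : ℝ, MeasurableSet (planeEquiv ⁻¹' Metric.ball (0 : ℂ) A) := fun A =>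
    (Metric.isOpen_ball.preimage planeEquiv.continuous).measurableSet
  refine ⟨locallyIntegrable_of_ball fun A hA => ?_,
    fun i j => locallyIntegrable_of_ball fun A hA => ?_, fun i j φ hφ hφc => ?_⟩
  · obtain ⟨F, P, W, hF, -, -, -, h2, -⟩ := exists_local_planar_gradient hw hwc hA
    refine (integrableOn_comp_planeEquiv hF swapCLM A).congr_fun (fun x hx => ?_) (hms A)
    exact (h2 x (by simpa using hx)).symm
  · obtain ⟨F, P, W, -, hP, hW, -, -, h3, -⟩ := exists_local_planar_gradient hw hwc hA
    refine Integrable.congr ((integrableOn_comp_planeEquiv hP (entryCLM i j) A).add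
      ((integrableOn_comp_planeEquiv hW Complex.reCLM A).mul_const
        ((!![0, -1; 1, 0] : Matrix (Fin 2) (Fin 2) ℝ) i j))) ?_
    rw [EventuallyEq, ae_restrict_iff' (hms A)]
    filter_upwards [h3] with x hx hxA
    exact ((hx (by simpa using hxA)).2.2 i j).symm
  · set v := planeEquiv (EuclideanSpace.single j 1)
    have hφC := contDiff_complexify hφ
    have hφCc := hasCompactSupport_complexify hφc
    obtain ⟨R, hR0, hR⟩ := HasCompactSupport.exists_forall_norm_lt hφCc
    obtain ⟨R', hR0', hR'⟩ := HasCompactSupport.exists_forall_norm_lt (hφCc.fderiv_apply ℝ v)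
    obtain ⟨F, P, W, hF, hP, hW, -, h2, h3, h4⟩ :=
      -- Outside this disc both `φ` and its derivative vanish, so the local formulas suffice.
      exists_local_planar_gradient hw hwc (A := R + R' + 1) (by positivity)
    obtain ⟨h5, h6⟩ := h4 _ hφC hφCc fun x hx => hR x (by linarith)
    have hint : ∀ {f g : ℂ → ℂ}, LocallyIntegrable f → ContDiff ℝ ∞ g → HasCompactSupport g →
        Integrable (fun x => f x * g x) := fun hf hg hgc =>
      by simpa [mul_comm] using hf.integrable_smul_left_of_hasCompactSupport hg.continuous hgc
    -- `Q` is `∂₁F = P + W` or `∂₂F = i(P - W)`. For real `W` the coordinates `(Im, Re)` of these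
    -- columns form the symmetric traceless matrix of `P` plus `W` times the rotation.
    obtain ⟨Q, hQ, hQF, hQe⟩ : ∃ Q : ℂ → ℂ, LocallyIntegrable Q ∧
        ∫ x, F x * fderiv ℝ (complexify φ) x v = -∫ x, Q x * complexify φ x ∧
        ∀ z, (W z).im = 0 → coordCLM i (Q z)
          = entryCLM i j (P z) + (W z).re * !![0, -1; 1, 0] i j := by
      fin_cases j
      · refine ⟨fun x => P x + W x, hP.add hW, ?_, fun z hz => ?_⟩
        · have hv' : v = 1 := planeEquiv_single_zero
          rw [hv']
          exact h5
        · fin_cases i <;> simp [coordCLM, entryCLM, hz]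
      · refine ⟨fun x => Complex.I * (P x - W x), (hP.sub hW).smul Complex.I, ?_, fun z hz => ?_⟩
        · have hv' : v = Complex.I := planeEquiv_single_one
          rw [hv']
          exact h6
        · fin_cases i <;> simp [coordCLM, entryCLM, hz, sub_eq_add_neg, add_comm]
    have e1 : ∀ x, velocity w x i * fderiv ℝ φ x (EuclideanSpace.single j 1)
        = coordCLM i (F (planeEquiv x) * fderiv ℝ (complexify φ) (planeEquiv x) v) := by
      intro x
      rw [fderiv_complexify hφ, coordCLM_mul_ofReal]
      by_cases hx : ‖planeEquiv x‖ < R + R' + 1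
      · rw [h2 x hx, swapCLM_apply]
      · have h0 := hR' (planeEquiv x) (by linarith)
        rw [fderiv_complexify hφ] at h0
        rw [Complex.ofReal_eq_zero.1 h0, mul_zero, mul_zero]
    have e2 : ∀ᵐ x, gradField w x i j * φ x
        = coordCLM i (Q (planeEquiv x) * complexify φ (planeEquiv x)) := by
      filter_upwards [h3] with x hx
      rw [complexify_planeEquiv, coordCLM_mul_ofReal]
      by_cases hxA : ‖planeEquiv x‖ < R + R' + 1
      · rw [(hx hxA).2.2, hQe _ (hx hxA).2.1]
      · have h0 := hR (planeEquiv x) (by linarith)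
        rw [complexify_planeEquiv] at h0
        rw [Complex.ofReal_eq_zero.1 h0, mul_zero, mul_zero]
    have hdc : HasCompactSupport fun z => fderiv ℝ (complexify φ) z v := hφCc.fderiv_apply ℝ v
    rw [integral_congr_ae (Eventually.of_forall e1), integral_congr_ae e2,
      measurePreserving_planeEquiv.integral_comp measurableEmbedding_planeEquiv
        (fun z => coordCLM i (F z * fderiv ℝ (complexify φ) z v)),
      measurePreserving_planeEquiv.integral_comp measurableEmbedding_planeEquiv
        (fun z => coordCLM i (Q z * complexify φ z)),
      (coordCLM i).integral_comp_comm (hint hF (contDiff_fderiv_apply_infty hφC v) hdc),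
      (coordCLM i).integral_comp_comm (hint hQ hφC hφCc), hQF, map_neg]

theorem ae_exists_hasPrincipalValue {w : Plane → ℝ} (hw : MemLp w ∞) (hwc : HasCompactSupport w) :
    ∀ᵐ x, ∃ P, HasPrincipalValue (fun y => w y • grad Kinf (x - y)) x P := by
  -- Countably many discs exhaust the plane, so the exceptional null sets can be united.
  have h : ∀ᵐ x, ∀ k : ℕ, ‖planeEquiv x‖ < (k : ℝ) + 1 →
      ∃ P, HasPrincipalValue (fun y => w y • grad Kinf (x - y)) x P := by
    rw [ae_all_iff]
    intro k
    obtain ⟨F, P, W, -, -, -, -, -, h3, -⟩ :=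
      exists_local_planar_gradient hw hwc (A := (k : ℝ) + 1) (by positivity)
    filter_upwards [h3] with x hx hxA using (hx hxA).1
  filter_upwards [h] with x hx
  obtain ⟨k, hk⟩ := exists_nat_ge ‖planeEquiv x‖
  exact hx k (by linarith)

theorem convolutionExists_Kinf {w : Plane → ℝ} (hw : MemLp w ∞) (hwc : HasCompactSupport w) :
    ConvolutionExists w Kinf (ContinuousLinearMap.lsmul ℝ ℝ) volume := by
  intro x
  obtain ⟨F, P, W, -, -, -, h1, -⟩ :=
    exists_local_planar_gradient hw hwc (A := ‖planeEquiv x‖ + 1) (by positivity)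
  exact h1 x (by linarith)

end PeriodicBiotSavart

end

theorem lemmaL (ω : PeriodicBiotSavart.Plane → ℝ)
    (hω : MemLp ω ∞ volume) (hsupp : HasCompactSupport ω) :
    -- the formula for the gradient of the kernel, off its singular set
    (∀ x : PeriodicBiotSavart.Plane, x ∉ PeriodicBiotSavart.lattice →
      0 < PeriodicBiotSavart.rho x ∧
      DifferentiableAt ℝ PeriodicBiotSavart.Kinf x ∧
      PeriodicBiotSavart.grad PeriodicBiotSavart.Kinf x
        = (Real.pi / 2) •
          ((1 / PeriodicBiotSavart.rho x ^ 2) • PeriodicBiotSavart.beta x)) ∧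
    -- the convolution `K_∞ * ω` converges absolutely everywhere
    ConvolutionExists ω PeriodicBiotSavart.Kinf (ContinuousLinearMap.lsmul ℝ ℝ) volume ∧
    -- the sum over `n` is finite at every point
    (∀ x : PeriodicBiotSavart.Plane,
      {n : ℤ | ω (x + PeriodicBiotSavart.shift n) ≠ 0}.Finite) ∧
    -- the formula for the gradient of the velocity
    ∃ G : PeriodicBiotSavart.Plane → Matrix (Fin 2) (Fin 2) ℝ,
      PeriodicBiotSavart.HasWeakGradient (PeriodicBiotSavart.velocity ω) G ∧
      ∀ᵐ x : PeriodicBiotSavart.Plane, ∃ P : Matrix (Fin 2) (Fin 2) ℝ,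
        PeriodicBiotSavart.HasPrincipalValue
          (fun y => ω y • PeriodicBiotSavart.grad PeriodicBiotSavart.Kinf (x - y)) x P ∧
        G x = (∑' n : ℤ, ω (x + PeriodicBiotSavart.shift n) / 2) • !![0, -1; 1, 0] + P := by
  refine ⟨fun x hx => ⟨PeriodicBiotSavart.rho_pos hx,
      (PeriodicBiotSavart.hasFDerivAt_Kinf hx).differentiableAt, PeriodicBiotSavart.grad_Kinf hx⟩,
    PeriodicBiotSavart.convolutionExists_Kinf hω hsupp,
    PeriodicBiotSavart.finite_shift_mem_support hsupp,
    PeriodicBiotSavart.gradField ω, PeriodicBiotSavart.hasWeakGradient_velocity hω hsupp, ?_⟩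
  filter_upwards [PeriodicBiotSavart.ae_exists_hasPrincipalValue hω hsupp] with x ⟨P, hP⟩
  exact ⟨P, hP, PeriodicBiotSavart.gradField_eq hP⟩
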